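/- Let $h\ge 1$ and let $\mathcal G_h$ be the half-infinite grid graph on $\mathbb N\times\{0,\dots,h-1\}$ (points are (column, row); two points are adjacent iff their distance is $1$). A *growing self-avoiding walk* (GSAW) is a finite directed walk that visits no vertex twice and whose last vertex is trapped, i.e. all its neighbours in $\mathcal G_h$ lie on the walk. Its displacement is the largest minus the smallest column of its vertices. Let $\mathcal S_{n,k}$ be the set of GSAWs on $\mathcal G_h$ starting at the top-left corner $(0,h-1)$ with $n$ edges and displacement $k$. **Frames.** A *path* is a nonempty sequence of distinct points, consecutive ones adjacent in $\mathcal G_h$; a *segment* is a nonempty ordered list of paths; a *frame* of width $w$ is an ordered list of segments with points in columns $0,\dots,w-1$, in which all the paths are pairwise vertex-disjoint. The *start* of a segment is the first point of its first path, its *end* the last point of its last path. A point is *trapped* in a frame if all its neighbours in the window of the frame are points of the frame. **Extension.** Let $F$ be a frame of width $2$ in which the start of every segment except possibly the first, and the end of every segment except possibly the last, are in the right column $1$. (Any other $F$ has no extensions.) An *extended frame* of $F$ is a frame $X$ of width $3$ obtained from $F$ as follows. (i) The start of every segment but the first and the end of every segment but the last are extended (starts backwards, ends forwards) rightward into the new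 column $2$ and then move up or down any number of edges in that column; the end of the last segment may be extended likewise if it is in column $1$, and the start of the first segment is not extended. (ii) The extended end of a segment may be connected, by an edge of column $2$, to the extended start of the next segment, and the two segments then merge into one; several merges are allowed. (iii) New segments may be inserted anywhere in the list except in the first position; each consists of a single path in column $2$, with at least two points unless it is the last segment of $X$. A new segment may be placed last only if the end of the last segment of $F$ was extended. No points may overlap. Call $X$ *valid* if it has a point in column $2$ and the following holds for the end $e$ of its last segment: if $e$ is in column $1$, or if $e$ is in column $2$ and is the only point of the last segment, then $e$ is trapped in $X$. *Trimming* $X$ means deleting the points of column $0$ with all incident edges (which may split paths into several; the resulting pieces stay in order within their segment) and shifting one column to the left. **The graph $D_h$.** The vertices of $D_h$ are all frames of width $2$ and one extra start vertex $s$. There is an edge $F\to F'$ of weight $x^ny$ whenever $F'$ is the trimming of a valid extended frame of $F$ that has $n$ more edges than $F$. There is an edge $s\to F$ of weight $x^dy$ for every valid first frame $F$, where $d$ is its number of edges; $F$ is a *valid first frame* if every segment is a single path, only the last segment may be a single point, the first segment exists and starts at $(0,h-1)$, all other segments start in column $1$, all segments except possibly the last end in column $1$, and the end of the last segment is trapped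 in $F$ if it is in column $0$ or if the last segment is a single point in column $1$. The accepting vertices are the frames with exactly one segment, whose end is in column $0$. The weight of a walk in $D_h$ is the product of the weights of its edges. **Theorem.** For all $n,k\ge 0$, the set of walks in $D_h$ that start at $s$, end at an accepting vertex and have weight $x^ny^k$ is in bijection with $\mathcal S_{n,k}$. Consequently the transfer matrix method applied to $D_h$ gives the generating function of GSAWs: $D_h$ is finite, each $\mathcal S_{n,k}$ is finite, and if $M$ is the matrix over $\mathbb Z[x,y]$ indexed by the vertices of $D_h$ whose $(u,v)$ entry is the sum of the weights of the edges from $u$ to $v$, then $I-M$ is invertible over $\mathbb Z[[x,y]]$ and $$\sum_{n,k\ge 0}|\mathcal S_{n,k}|\,x^ny^k=\sum_{t\ \text{accepting}}\bigl((I-M)^{-1}\bigr)_{s,t}.$$ -/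

import Mathlib

/-! # Growing self-avoiding walks on a half-infinite strip and their frame machine -/

namespace Strip

/-! ## The strip and its growing self-avoiding walks -/

/-- The half-infinite grid graph of height `h`: its vertices are `(column, row)` with column in `ℕ`
and row in `{0, …, h - 1}`, and two vertices are adjacent when they are at distance one. -/
def grid (h : ℕ) : SimpleGraph (ℕ × Fin h) where
  Adj p q :=
    (p.1 = q.1 ∧ (p.2.val + 1 = q.2.val ∨ q.2.val + 1 = p.2.val)) ∨
    (p.2 = q.2 ∧ (p.1 + 1 = q.1 ∨ q.1 + 1 = p.1))
  symm := ⟨by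
    rintro p q (⟨h1, h2⟩ | ⟨h1, h2⟩)
    · exact Or.inl ⟨h1.symm, h2.symm⟩
    · exact Or.inr ⟨h1.symm, h2.symm⟩⟩
  loopless := ⟨by
    rintro p (⟨_, h2⟩ | ⟨_, h2⟩) <;> omega⟩

/-- The top-left corner `(0, h - 1)`. -/
def topLeft (h : ℕ) (hh : 0 < h) : ℕ × Fin h := (0, ⟨h - 1, by omega⟩)

/-- A growing self-avoiding walk on `G` starting at `v`: a walk that visits no vertex twice and
whose last vertex is trapped, i.e. all neighbours of the last vertex are on the walk. -/
structure GSAW {V : Type*} (G : SimpleGraph V) (v : V) where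
  last : V
  walk : G.Walk v last
  isPath : walk.IsPath
  trapped : ∀ u, G.Adj last u → u ∈ walk.support

/-- The number of edges. -/
def GSAW.length {V : Type*} {G : SimpleGraph V} {v : V} (W : GSAW G v) : ℕ := W.walk.length

/-- The largest minus the smallest column of the vertices of the walk. -/
noncomputable def GSAW.displacement {h : ℕ} {v : ℕ × Fin h} (W : GSAW (grid h) v) : ℕ :=
  sSup (Prod.fst '' {p | p ∈ W.walk.support}) - sInf (Prod.fst '' {p | p ∈ W.walk.support})

/-- The growing self-avoiding walks from the top-left corner with `n` edges and displacement `k`. -/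
abbrev GSAWs (h : ℕ) (hh : 0 < h) (n k : ℕ) : Type :=
  {W : GSAW (grid h) (topLeft h hh) // W.length = n ∧ W.displacement = k}

/-- The series `∑ x ^ length * y ^ displacement` over all growing self-avoiding walks from the
top-left corner, with `x` the variable `0` and `y` the variable `1`. -/
noncomputable def gsawSeries (h : ℕ) (hh : 0 < h) : MvPowerSeries (Fin 2) ℤ :=
  fun m => (Nat.card (GSAWs h hh (m 0) (m 1)) : ℤ)

/-! ## Frames -/

/-- A segment, as an ordered list of paths; each path is the list of the points it visits. -/
abbrev Segment (h : ℕ) : Type := List (List (ℕ × Fin h))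

/-- All points of an ordered list of segments. -/
def vertices {h : ℕ} (F : List (Segment h)) : List (ℕ × Fin h) := F.flatten.flatten

/-- The number of edges of an ordered list of segments. -/
def edgeCount {h : ℕ} (F : List (Segment h)) : ℕ := (F.flatten.map fun P => P.length - 1).sum

/-- `F` is a frame in the window of columns `0, …, w - 1`: an ordered list of nonempty segments,
each an ordered list of nonempty directed paths, in which no point is used twice. -/
structure IsFrame {h : ℕ} (w : ℕ) (F : List (Segment h)) : Prop where
  segment_ne_nil : ∀ S ∈ F, S ≠ []
  path_ne_nil : ∀ S ∈ F, ∀ P ∈ S, P ≠ []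
  isChain : ∀ S ∈ F, ∀ P ∈ S, P.IsChain (grid h).Adj
  nodup : (vertices F).Nodup
  window : ∀ p ∈ vertices F, p.1 < w

/-- The frames of width `w` and height `h`. -/
abbrev Frame (h w : ℕ) : Type := {F : List (Segment h) // IsFrame w F}

/-- The start of a segment (first point of its first path) lies in column `c`. -/
def StartsIn {h : ℕ} (c : ℕ) (S : Segment h) : Prop := ∃ p ∈ S.flatten.head?, p.1 = c

/-- The end of a segment (last point of its last path) lies in column `c`. -/
def EndsIn {h : ℕ} (c : ℕ) (S : Segment h) : Prop := ∃ p ∈ S.flatten.getLast?, p.1 = c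

/-- Every neighbour of `e` in the window of columns `0, …, w - 1` is occupied. -/
def Trapped {h : ℕ} (w : ℕ) (F : List (Segment h)) (e : ℕ × Fin h) : Prop :=
  ∀ q, (grid h).Adj e q → q.1 < w → q ∈ vertices F

/-! ## Extending a frame of width 2 to width 3

The new column is column `2`. -/

/-- Put the points `pre` in front of the first path of a segment. -/
def extendStart {h : ℕ} (pre : List (ℕ × Fin h)) : Segment h → Segment h
  | [] => []
  | P :: S => (pre ++ P) :: S

/-- Put the points `suf` behind the last path of a segment. -/
def extendEnd {h : ℕ} (suf : List (ℕ × Fin h)) : Segment h → Segment h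
  | [] => []
  | [P] => [P ++ suf]
  | P :: Q :: S => P :: extendEnd suf (Q :: S)

/-- The segment obtained when the end of the first segment runs into the start of the second. -/
def joinSegments {h : ℕ} : Segment h → Segment h → Segment h
  | [], T => T
  | [P], [] => [P]
  | [P], Q :: T => (P ++ Q) :: T
  | P :: P' :: S, T => P :: joinSegments (P' :: S) T

/-- `Merges L L'`: `L'` arises from `L` by merging some consecutive segments, the end of each with
the start of the next one. -/
inductive Merges {h : ℕ} : List (Segment h) → List (Segment h) → Prop
  | nil : Merges [] []
  | keep {S : Segment h} {L L' : List (Segment h)} : Merges L L' → Merges (S :: L) (S :: L')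
  | join {S T : Segment h} {L L' : List (Segment h)} :
      Merges (joinSegments S T :: L) L' → Merges (S :: T :: L) L'

/-- `Inserts q L X`: `X` arises from `L` by inserting new segments, each a single path in column
`2`. Only the last segment of `X` may be a new single point, and a new segment may come behind
all segments of `L` only if `q` holds. -/
inductive Inserts {h : ℕ} (q : Prop) : List (Segment h) → List (Segment h) → Prop
  | nil : Inserts q [] []
  | old {S : Segment h} {L X : List (Segment h)} : Inserts q L X → Inserts q (S :: L) (S :: X)
  | new {P : List (ℕ × Fin h)} {L X : List (Segment h)} :
      (∀ p ∈ P, p.1 = 2) → (X ≠ [] → 2 ≤ P.length) → (L = [] → q) →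
      Inserts q L X → Inserts q L ([P] :: X)

/-- The segments of `F`, lengthened by `A`: the entry of `A` for a segment holds the points of the
new column put before its start and those put behind its end. All starts but the first are
extended and all ends but the last; the end of the last segment may be extended. That the new
points continue the paths of `F` along edges, without overlap, is checked on the final frame. -/
structure IsLengthening {h : ℕ} (F : List (Segment h))
    (A : List (List (ℕ × Fin h) × List (ℕ × Fin h))) : Prop where
  length_eq : A.length = F.length
  column : ∀ a ∈ A, ∀ p ∈ a.1 ++ a.2, p.1 = 2
  first_start : ∀ a ∈ A.head?, a.1 = []
  starts : ∀ a ∈ A.tail, a.1 ≠ []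
  ends : ∀ a ∈ A.dropLast, a.2 ≠ []

/-- `X` is an extended frame of `F`. -/
def IsExtension {h : ℕ} (F : Frame h 2) (X : Frame h 3) : Prop :=
  (∀ S ∈ F.1.tail, StartsIn 1 S) ∧ (∀ S ∈ F.1.dropLast, EndsIn 1 S) ∧
  ∃ A, IsLengthening F.1 A ∧
    ∃ (S : Segment h) (L X' : List (Segment h)),
      Merges (List.zipWith (fun a T => extendEnd a.2 (extendStart a.1 T)) A F.1) (S :: L) ∧
      Inserts (∃ a ∈ A.getLast?, a.2 ≠ []) L X' ∧
      X.1 = S :: X'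

/-- `X` is an extended frame of `F` that may be part of a growing self-avoiding walk. The new
column is really used, and if the end of the last segment is the last point of the walk because it
was left behind in the middle column, or because it is a segment of its own in the new column, then
it is trapped. (An end in the leftmost column was left behind earlier and needs no new test.) -/
def IsValidExtension {h : ℕ} (F : Frame h 2) (X : Frame h 3) : Prop :=
  IsExtension F X ∧ (∃ p ∈ vertices X.1, p.1 = 2) ∧
  ∀ S ∈ X.1.getLast?, ∀ e ∈ S.flatten.getLast?,
    (e.1 = 1 ∨ (e.1 = 2 ∧ S = [[e]])) → Trapped 3 X.1 e

/-- Remove column `0` with all incident edges, splitting paths where needed, and move the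
remaining points one column to the left. -/
def trim {h : ℕ} (X : List (Segment h)) : List (Segment h) :=
  X.map fun S =>
    ((S.flatMap fun P => P.splitOnP fun p => p.1 == 0).filter fun P => !P.isEmpty).map
      fun P => P.map fun p => (p.1 - 1, p.2)

/-- The valid first frames. -/
structure IsFirstFrame {h : ℕ} (F : List (Segment h)) : Prop where
  single_path : ∀ S ∈ F, S.length = 1
  not_point : ∀ S ∈ F.dropLast, 2 ≤ S.flatten.length
  corner : ∃ S ∈ F.head?, ∃ p ∈ S.flatten.head?, p.1 = 0 ∧ p.2.val + 1 = h
  starts : ∀ S ∈ F.tail, StartsIn 1 S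
  ends : ∀ S ∈ F.dropLast, EndsIn 1 S
  trapped : ∀ S ∈ F.getLast?, ∀ e ∈ S.flatten.getLast?,
    (e.1 = 0 ∨ (e.1 = 1 ∧ S = [[e]])) → Trapped 2 F e

/-! ## The weighted directed graph -/

/-- The vertices of the directed graph: the start vertex and all frames of width 2. -/
inductive State (h : ℕ) : Type
  | start : State h
  | frame (F : Frame h 2) : State h

/-- `HasEdge u v n`: there is an edge from `u` to `v` that adds `n` edges of the strip. -/
def HasEdge {h : ℕ} : State h → State h → ℕ → Prop
  | .start, .frame F, n => IsFirstFrame F.1 ∧ n = edgeCount F.1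
  | .frame F, .frame F', n =>
      ∃ X : Frame h 3, IsValidExtension F X ∧ F'.1 = trim X.1 ∧ edgeCount X.1 = edgeCount F.1 + n
  | _, .start, _ => False

/-- The directed graph of frames. -/
instance instQuiverState (h : ℕ) : Quiver (State h) := ⟨fun u v => {n : ℕ // HasEdge u v n}⟩

/-- The weight `x ^ n * y` of an edge. -/
noncomputable def edgeWeight {h : ℕ} {u v : State h} (e : u ⟶ v) : MvPolynomial (Fin 2) ℤ :=
  MvPolynomial.X 0 ^ e.1 * MvPolynomial.X 1

/-- The accepting vertices: frames with one segment whose end is in the left column. -/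
def IsAccepting {h : ℕ} : State h → Prop
  | .start => False
  | .frame F => ∃ S, F.1 = [S] ∧ EndsIn 0 S

abbrev AcceptingState (h : ℕ) : Type := {t : State h // IsAccepting t}

/-- The walks from the start vertex to an accepting vertex whose weight, the product of the weights
of their edges, is `x ^ n * y ^ k`. -/
abbrev AcceptedWalks (h n k : ℕ) : Type :=
  {w : Σ t : AcceptingState h, Quiver.Path (State.start : State h) t.1 //
    w.2.weight edgeWeight = MvPolynomial.X 0 ^ n * MvPolynomial.X 1 ^ k}

/-! ## Finiteness and the transfer matrix -/

theorem finite_lists {α : Type*} {s : Set α} (hs : s.Finite) (n : ℕ) :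
    {l : List α | (∀ x ∈ l, x ∈ s) ∧ l.length ≤ n}.Finite := by
  have : Finite s := hs
  refine ((List.finite_length_le s n).image (List.map Subtype.val)).subset ?_
  rintro l ⟨h1, h2⟩
  refine ⟨l.attach.map fun x => ⟨x.1, h1 x.1 x.2⟩, by simpa using h2, ?_⟩
  simp

theorem length_le_length_flatten {α : Type*} {L : List (List α)} (hL : ∀ l ∈ L, l ≠ []) :
    L.length ≤ L.flatten.length := by
  induction L with
  | nil => simp
  | cons a L ih =>
    have h1 := ih fun l hl => hL l (by simp [hl])
    have h2 := List.length_pos_iff.2 (hL a (by simp))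
    simp only [List.length_cons, List.flatten_cons, List.length_append]
    omega

theorem length_le_of_mem {α : Type*} {L : List (List α)} {l : List α} (hl : l ∈ L) :
    l.length ≤ L.flatten.length :=
  (List.sublist_flatten_of_mem hl).length_le

instance finite_frame (h w : ℕ) : Finite (Frame h w) := by
  have hp : {p : ℕ × Fin h | p.1 < w}.Finite :=
    ((Set.finite_lt_nat w).prod (Set.finite_univ (α := Fin h))).subset fun p hp => ⟨hp, trivial⟩
  obtain ⟨N, hN⟩ : ∃ N : ℕ, ∀ l : List (ℕ × Fin h), l.Nodup → (∀ p ∈ l, p.1 < w) →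
      l.length ≤ N := by
    refine ⟨hp.toFinset.card, fun l hl hlw => ?_⟩
    rw [← List.toFinset_card_of_nodup hl]
    exact Finset.card_le_card fun p hpl => by simpa using hlw p (by simpa using hpl)
  refine ((finite_lists (finite_lists (finite_lists hp N) N) N).subset ?_).to_subtype
  intro F hF
  have hv := hN _ hF.nodup hF.window
  have hP : ∀ P ∈ F.flatten, P ≠ [] := by
    intro P hP
    obtain ⟨S, hS, hPS⟩ := List.mem_flatten.1 hP
    exact hF.path_ne_nil S hS P hPS
  have h1 : F.flatten.length ≤ N := (length_le_length_flatten hP).trans hv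
  refine ⟨fun S hS => ⟨fun P hPS => ⟨fun p hpP => ?_, ?_⟩, ?_⟩, ?_⟩
  · exact hF.window p (List.mem_flatten.2 ⟨P, List.mem_flatten.2 ⟨S, hS, hPS⟩, hpP⟩)
  · exact (length_le_of_mem (List.mem_flatten.2 ⟨S, hS, hPS⟩)).trans hv
  · exact (length_le_of_mem hS).trans h1
  · exact (length_le_length_flatten hF.segment_ne_nil).trans h1

instance finite_state (h : ℕ) : Finite (State h) :=
  Finite.of_surjective
    (fun o : Option (Frame h 2) => match o with | none => State.start | some F => State.frame F)
    (by rintro (_ | F); exacts [⟨none, rfl⟩, ⟨some F, rfl⟩])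

instance finite_hom {h : ℕ} (u v : State h) : Finite (u ⟶ v) := by
  have key : ∀ m : ℕ, {n : ℕ | ∃ X : Frame h 3, edgeCount X.1 = m + n}.Finite := fun m =>
    (Set.finite_range fun X : Frame h 3 => edgeCount X.1 - m).subset
      (by rintro n ⟨X, hX⟩; exact ⟨X, by simp [hX]⟩)
  suffices hf : {n : ℕ | HasEdge u v n}.Finite from hf.to_subtype
  rcases u with _ | F <;> rcases v with _ | F'
  · simp [HasEdge]
  · exact (Set.finite_singleton (edgeCount F'.1)).subset fun n (hn : _ ∧ _) => hn.2
  · simp [HasEdge]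
  · refine (key (edgeCount F.1)).subset ?_
    rintro n ⟨X, hX⟩
    exact ⟨X, hX.2.2⟩

noncomputable instance instFintypeState (h : ℕ) : Fintype (State h) := Fintype.ofFinite _

noncomputable instance instDecidableEqState (h : ℕ) : DecidableEq (State h) := Classical.decEq _

noncomputable instance instFintypeHom {h : ℕ} (u v : State h) : Fintype (u ⟶ v) :=
  Fintype.ofFinite _

noncomputable instance instFintypeAccepting (h : ℕ) : Fintype (AcceptingState h) :=
  Fintype.ofFinite _

/-- The adjacency matrix: the entry at `(u, v)` is the sum of the weights of the edges from `u`
to `v`. -/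
noncomputable def adjacency (h : ℕ) : Matrix (State h) (State h) (MvPolynomial (Fin 2) ℤ) :=
  Matrix.of fun u v => ∑ e : (u ⟶ v), edgeWeight e

/-- `1 - M` for the adjacency matrix `M`, over the ring of formal power series in `x` and `y`. -/
noncomputable def oneSubAdjacency (h : ℕ) :
    Matrix (State h) (State h) (MvPowerSeries (Fin 2) ℤ) :=
  1 - (adjacency h).map fun p => (p : MvPowerSeries (Fin 2) ℤ)

end Strip

/-! The walk is swept from left to right. Cutting it down to the columns `≤ c` leaves an ordered
list of maximal pieces. Between two consecutive pieces the walk is beyond column `c`, so every piece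
but the last ends in column `c`, and every piece but the first starts there. `IsPartialWalk c`
collects the properties of such a list. The frame reached after `c` steps is the picture of a
partial walk in the columns `c - 1` and `c`: one segment per piece, consisting of the parts of the
piece in these columns (`window (c - 1)`).

The core is that an edge between frames is the same thing as passing from column `i + 1` to column
`i + 2`. Restricting a partial walk gives a partial walk (`IsPartialWalk.restrict_columns`), and its
picture in the columns `i`, `i + 1`, `i + 2` is a valid extension of the smaller picture
(`IsPartialWalk.isValidExtension`). Conversely every valid extension is the picture of a longer
partial walk with the given restriction (`IsPartialWalk.exists_extension`). An edge of the strip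
changes the column by at most one, so it lies in the columns `≤ i + 1`, where the old partial walk
records it, or in the columns `≥ i`, where the extended frame shows it. Adjacency, disjointness and
the edge count can be checked on these two overlapping halves.

Induction over the columns yields `Traces`: every walk of frames records a partial walk
(`exists_traces`), and every partial walk is recorded (`exists_path_of_isPartialWalk`). The partial
walk and the number of steps determine the walk of frames (`Traces.path_unique`), which in turn
determines the edges of the partial walk (`Traces.mem_pairs`); a single path with known start is
determined by its directed edges. A growing self-avoiding walk of displacement `k` is a partial walk
up to column `k` with one piece and with its end left of column `k`, because the right neighbour of
the end is visited. This is what acceptance expresses.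

For the generating function, the entries of `M ^ j` sum over walks with `j` edges and are divisible
by `y ^ j`. Hence `I - M` is the identity modulo `y`, and only the walks with `k` edges contribute
to `y ^ k` in its inverse. -/

namespace Strip

/-! ## Consecutive pairs and maximal runs of a list -/

/-- The pairs of consecutive entries of a list. -/
def pairs {α : Type*} : List α → List (α × α)
  | [] => []
  | [_] => []
  | a :: b :: l => (a, b) :: pairs (b :: l)

/-- The maximal blocks of consecutive entries of a list that satisfy `p`. -/
def runs {α : Type*} (p : α → Bool) (l : List α) : List (List α) :=
  (l.splitOnP fun a => !p a).filter fun P => !P.isEmpty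

section Lists

variable {α β : Type*} {p q : α → Bool}

theorem isChain_iff_pairs {R : α → α → Prop} {l : List α} :
    l.IsChain R ↔ ∀ x ∈ pairs l, R x.1 x.2 := by
  induction l with
  | nil => simp [pairs]
  | cons a l ih =>
    cases l with
    | nil => simp [pairs]
    | cons b l => rw [List.isChain_cons_cons, ih, pairs, List.forall_mem_cons]

theorem length_pairs (l : List α) : (pairs l).length = l.length - 1 := by
  induction l with
  | nil => simp [pairs]
  | cons a l ih =>
    cases l with
    | nil => simp [pairs]
    | cons b l => simp [pairs, ih]

theorem mem_of_mem_pairs {l : List α} {x : α × α} (hx : x ∈ pairs l) : x.1 ∈ l ∧ x.2 ∈ l := by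
  induction l with
  | nil => simp [pairs] at hx
  | cons a l ih =>
    cases l with
    | nil => simp [pairs] at hx
    | cons b l =>
      rw [pairs, List.mem_cons] at hx
      rcases hx with rfl | hx
      · simp
      · exact ⟨List.mem_cons_of_mem _ (ih hx).1, List.mem_cons_of_mem _ (ih hx).2⟩

theorem pairs_map (f : α → β) (l : List α) : pairs (l.map f) = (pairs l).map (Prod.map f f) := by
  induction l with
  | nil => simp [pairs]
  | cons a l ih =>
    cases l with
    | nil => simp [pairs]
    | cons b l => simpa [pairs] using ih

theorem mem_pairs_append_left {l m : List α} {x : α × α} (hx : x ∈ pairs l) :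
    x ∈ pairs (l ++ m) := by
  induction l with
  | nil => simp [pairs] at hx
  | cons a l ih =>
    cases l with
    | nil => simp [pairs] at hx
    | cons b l =>
      simp only [pairs, List.cons_append, List.mem_cons] at hx ih ⊢
      exact hx.imp id ih

theorem mem_pairs_append_right {l m : List α} {x : α × α} (hx : x ∈ pairs m) :
    x ∈ pairs (l ++ m) := by
  induction l with
  | nil => simpa
  | cons a l ih =>
    cases hl : l ++ m with
    | nil => simp [hl, pairs] at ih
    | cons b t => rw [hl] at ih; simp [hl, pairs, ih]

theorem mem_pairs_append {l m : List α} {a b : α} (ha : a ∈ l.getLast?) (hb : b ∈ m.head?) :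
    (a, b) ∈ pairs (l ++ m) := by
  obtain ⟨l, rfl⟩ := List.mem_getLast?_eq_getLast ha |>.elim fun h e =>
    (⟨l.dropLast, by rw [e, List.dropLast_append_getLast h]⟩ : ∃ l', l = l' ++ [a])
  obtain ⟨m, rfl⟩ := List.head?_eq_some_iff.1 hb
  rw [List.append_assoc]
  exact mem_pairs_append_right (by simp [pairs])

/-- A list without repetitions is determined by its first entry and its consecutive pairs. -/
theorem eq_of_pairs {l m : List α} (hl : l.Nodup) (hm : m.Nodup) (hh : l.head? = m.head?)
    (hp : ∀ x, x ∈ pairs l ↔ x ∈ pairs m) : l = m := by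
  induction l generalizing m with
  | nil => simpa [eq_comm] using hh
  | cons a l ih =>
    obtain _ | ⟨a', m⟩ := m
    · simp at hh
    obtain rfl : a = a' := by simpa using hh
    rw [List.nodup_cons] at hl hm
    -- As `a` does not recur, the pair starting with `a` is the only one lost when `a` is removed.
    have key : ∀ {l m : List α}, a ∉ l → (∀ x, x ∈ pairs (a :: l) ↔ x ∈ pairs (a :: m)) →
        ∀ x ∈ pairs l, x ∈ pairs m := by
      intro l m hal h x hx
      obtain _ | ⟨b, m⟩ := m
      · exact absurd ((h x).1 (mem_pairs_append_right (l := [a]) hx)) (by simp [pairs])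
      · have := (h x).1 (mem_pairs_append_right (l := [a]) hx)
        rw [pairs, List.mem_cons] at this
        rcases this with rfl | h'
        · exact absurd (mem_of_mem_pairs hx).1 hal
        · exact h'
    -- The next entry is the only successor of `a`, again because `a` does not recur.
    have hd : ∀ {l m : List α}, a ∉ m → (∀ x, x ∈ pairs (a :: l) ↔ x ∈ pairs (a :: m)) →
        ∀ b ∈ l.head?, b ∈ m.head? := by
      intro l m ham h b hb
      obtain ⟨l, rfl⟩ := List.head?_eq_some_iff.1 hb
      have := (h (a, b)).1 (by simp [pairs])
      obtain _ | ⟨c, m⟩ := m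
      · simp [pairs] at this
      · rw [pairs, List.mem_cons] at this
        rcases this with h' | h'
        · simp only [Prod.mk.injEq, true_and] at h'
          simp [h']
        · exact absurd (mem_of_mem_pairs h').1 ham
    rw [ih hl.2 hm.2 (Option.ext fun b => ⟨hd hm.1 hp b, hd hl.1 (fun x => (hp x).symm) b⟩)
      fun x => ⟨key hl.1 hp x, key hm.1 (fun x => (hp x).symm) x⟩]

/-- Converts links between neighbours into conditions on all ends but the last and all starts but
the first, the form in which frames state them. -/
theorem isChain_and_iff {P Q : α → Prop} {l : List α} :
    l.IsChain (fun x y => P x ∧ Q y) ↔ (∀ x ∈ l.dropLast, P x) ∧ ∀ y ∈ l.tail, Q y := by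
  induction l with
  | nil => simp
  | cons a l ih =>
    cases l with
    | nil => simp
    | cons b l =>
      simp only [List.isChain_cons_cons, ih, List.dropLast_cons_cons, List.mem_cons,
        List.tail_cons, forall_eq_or_imp]
      tauto

/-! ### Runs -/

@[simp] theorem runs_nil : runs p ([] : List α) = [] := by simp [runs]

theorem runs_cons_neg {a : α} (ha : p a = false) (l : List α) : runs p (a :: l) = runs p l := by
  simp [runs, List.splitOnP_cons_eq_if_modifyHead, ha]

theorem runs_singleton {a : α} (ha : p a = true) : runs p [a] = [[a]] := by
  simp [runs, List.splitOnP_cons_eq_if_modifyHead, ha]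

theorem runs_cons_cons_neg {a b : α} (ha : p a = true) (hb : p b = false) (l : List α) :
    runs p (a :: b :: l) = [a] :: runs p (b :: l) := by
  simp [runs, List.splitOnP_cons_eq_if_modifyHead, ha, hb]

theorem runs_cons_cons_pos {a b : α} (ha : p a = true) (hb : p b = true) (l : List α) :
    ∃ t R, runs p (b :: l) = (b :: t) :: R ∧ runs p (a :: b :: l) = (a :: b :: t) :: R := by
  obtain ⟨t, R, h⟩ := List.exists_cons_of_ne_nil (List.splitOnP_ne_nil (fun a => !p a) l)
  refine ⟨t, R.filter fun P => !P.isEmpty, ?_⟩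
  simp [runs, List.splitOnP_cons_eq_if_modifyHead, ha, hb, h]

/-- Induction along the recursive description of the runs. -/
theorem runs_induction {motive : List α → List (List α) → Prop} (p : α → Bool)
    (nil : motive [] [])
    (neg : ∀ a l, p a = false → motive l (runs p l) → motive (a :: l) (runs p l))
    (single : ∀ a, p a = true → motive [a] [[a]])
    (cons_neg : ∀ a b l, p a = true → p b = false → motive (b :: l) (runs p (b :: l)) →
      motive (a :: b :: l) ([a] :: runs p (b :: l)))
    (cons_pos : ∀ a b l t R, p a = true → p b = true → runs p (b :: l) = (b :: t) :: R →
      motive (b :: l) ((b :: t) :: R) → motive (a :: b :: l) ((a :: b :: t) :: R))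
    (l : List α) : motive l (runs p l) := by
  induction l with
  | nil => simpa using nil
  | cons a l ih =>
    cases ha : p a with
    | false => rw [runs_cons_neg ha]; exact neg a l ha ih
    | true =>
      cases l with
      | nil => rw [runs_singleton ha]; exact single a ha
      | cons b l =>
        cases hb : p b with
        | false => rw [runs_cons_cons_neg ha hb]; exact cons_neg a b l ha hb ih
        | true =>
          obtain ⟨t, R, h1, h2⟩ := runs_cons_cons_pos ha hb l
          rw [h2]
          exact cons_pos a b l t R ha hb h1 (h1 ▸ ih)

theorem ne_nil_of_mem_runs {l P : List α} (hP : P ∈ runs p l) : P ≠ [] := by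
  simp only [runs, List.mem_filter] at hP
  rintro rfl
  simp at hP

theorem flatten_runs (l : List α) : (runs p l).flatten = l.filter p := by
  refine runs_induction (motive := fun l R => R.flatten = l.filter p) p ?_ ?_ ?_ ?_ ?_ l <;>
    simp +contextual

theorem runs_eq_singleton {l : List α} (hl : l ≠ []) (h : ∀ a ∈ l, p a = true) :
    runs p l = [l] := by
  revert hl h
  refine runs_induction (motive := fun l R => l ≠ [] → (∀ a ∈ l, p a = true) → R = [l])
    p ?_ ?_ ?_ ?_ ?_ l <;> simp +contextual

theorem runs_eq_nil {l : List α} (h : ∀ a ∈ l, p a = false) : runs p l = [] := by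
  revert h
  refine runs_induction (motive := fun l R => (∀ a ∈ l, p a = false) → R = [])
    p ?_ ?_ ?_ ?_ ?_ l <;> simp +contextual

theorem runs_ne_nil {l : List α} {a : α} (ha : a ∈ l) (hp : p a = true) : runs p l ≠ [] := by
  intro h
  have := flatten_runs (p := p) l
  rw [h] at this
  exact absurd (List.mem_filter.2 ⟨ha, hp⟩) (by simp [← this])

/-- A cut separates two consecutive entries only if one of them fails `p`, so the edges of the runs
are the edges inside the region. -/
theorem flatMap_pairs_runs (l : List α) :
    (runs p l).flatMap pairs = (pairs l).filter fun x => p x.1 && p x.2 := by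
  refine runs_induction
    (motive := fun l R => R.flatMap pairs = (pairs l).filter fun x => p x.1 && p x.2)
    p ?_ ?_ ?_ ?_ ?_ l
  · simp [pairs]
  · intro a l ha ih
    cases l with
    | nil => simp [pairs]
    | cons b l => simp [pairs, ha, ih]
  · simp [pairs]
  · intro a b l ha hb ih
    simp [pairs, hb, ih]
  · intro a b l t R ha hb _ ih
    simpa [pairs, ha, hb] using ih

theorem runs_map (f : α → β) (r : β → Bool) (l : List α) :
    runs r (l.map f) = (runs (r ∘ f) l).map (List.map f) := by
  refine runs_induction (motive := fun l R => runs r (l.map f) = R.map (List.map f))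
    (r ∘ f) ?_ ?_ ?_ ?_ ?_ l
  · simp
  · intro a l ha ih
    rw [List.map_cons, runs_cons_neg (p := r) ha, ih]
  · intro a ha
    simp [runs_singleton (p := r) ha]
  · intro a b l ha hb ih
    simp only [List.map_cons] at ih ⊢
    rw [runs_cons_cons_neg (p := r) ha hb, ih]
    rfl
  · intro a b l t R ha hb _ ih
    obtain ⟨t', R', h1, h2⟩ := runs_cons_cons_pos (p := r) (a := f a) (b := f b) ha hb (l.map f)
    simp only [List.map_cons] at ih ⊢
    rw [h1] at ih
    rw [h2]
    simpa using ih

/-- Every entry deleted for `p` would also be deleted for `q`, so cutting in two stages has the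
effect of the finer cut. This makes repeated trimming consistent. -/
theorem flatMap_runs_runs (hqp : ∀ a, q a = true → p a = true) (l : List α) :
    (runs p l).flatMap (runs q) = runs q l := by
  have hn : ∀ a, p a = false → q a = false := fun a ha => by
    by_contra h; simp [hqp a (by simpa using h)] at ha
  refine runs_induction (motive := fun l R => R.flatMap (runs q) = runs q l) p ?_ ?_ ?_ ?_ ?_ l
  · simp
  · intro a l ha ih
    rw [runs_cons_neg (hn a ha), ih]
  · simp
  · intro a b l ha hb ih
    rw [List.flatMap_cons, ih, runs_cons_neg (hn b hb)]
    cases hq : q a with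
    | false => simp [runs_cons_neg hq, runs_cons_neg (hn b hb)]
    | true => rw [runs_cons_cons_neg hq (hn b hb), runs_singleton hq, runs_cons_neg (hn b hb)]; rfl
  · intro a b l t R ha hb _ ih
    rw [List.flatMap_cons] at ih ⊢
    cases hq : q a with
    | false => rw [runs_cons_neg hq, ih, runs_cons_neg hq]
    | true =>
      cases hqb : q b with
      | false => rw [runs_cons_cons_neg hq hqb, List.cons_append, ih, runs_cons_cons_neg hq hqb]
      | true =>
        obtain ⟨t1, R1, h1, h2⟩ := runs_cons_cons_pos hq hqb t
        obtain ⟨t2, R2, h3, h4⟩ := runs_cons_cons_pos hq hqb l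
        rw [h1, h3] at ih
        rw [h2, h4]
        simpa using ih

/-- Runs of a concatenation, cut at an entry that fails the predicate. -/
theorem runs_append {l m : List α}
    (h : (∀ a ∈ l.getLast?, p a = false) ∨ ∀ b ∈ m.head?, p b = false) :
    runs p (l ++ m) = runs p l ++ runs p m := by
  revert h
  refine runs_induction
    (motive := fun l R => ((∀ a ∈ l.getLast?, p a = false) ∨ ∀ b ∈ m.head?, p b = false) →
      runs p (l ++ m) = R ++ runs p m) p ?_ ?_ ?_ ?_ ?_ l
  · simp
  · intro a l ha ih h
    rw [List.cons_append, runs_cons_neg ha]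
    cases l with
    | nil => simp
    | cons b l => exact ih (by simpa [List.getLast?_cons_cons] using h)
  · intro a ha h
    cases m with
    | nil => simp [runs_singleton ha]
    | cons b m =>
      have hb : p b = false := by simpa [ha] using h
      simpa using runs_cons_cons_neg ha hb m
  · intro a b l ha hb ih h
    have := ih (by simpa [List.getLast?_cons_cons] using h)
    simp only [List.cons_append] at this ⊢
    rw [runs_cons_cons_neg ha hb, this]
  · intro a b l t R ha hb _ ih h
    have := ih (by simpa [List.getLast?_cons_cons] using h)
    simp only [List.cons_append] at this ⊢
    obtain ⟨t2, R2, h3, h4⟩ := runs_cons_cons_pos ha hb (l ++ m)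
    rw [h3] at this
    rw [h4]
    simpa using this

end Lists

/-! ### Runs and the joining operations on segments -/

section Segments

variable {h : ℕ} {p : ℕ × Fin h → Bool}

/-- No cut falls at the junction, so the last run of `l` fuses with the first run of `m` and all
others persist. Merging segments is thus the picture of concatenating paths. -/
theorem runs_append_joinSegments {l m : List (ℕ × Fin h)} (hl : l ≠ [])
    (hl' : ∀ a ∈ l.getLast?, p a = true) {b : ℕ × Fin h} (hb : b ∈ m.head?) (hpb : p b = true) :
    runs p (l ++ m) = joinSegments (runs p l) (runs p m) := by
  obtain ⟨m, rfl⟩ := List.head?_eq_some_iff.1 hb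
  revert hl hl'
  refine runs_induction
    (motive := fun l R => l ≠ [] → (∀ a ∈ l.getLast?, p a = true) →
      runs p (l ++ b :: m) = joinSegments R (runs p (b :: m))) p ?_ ?_ ?_ ?_ ?_ l
  · simp
  · intro a l ha ih _ h
    rw [List.cons_append, runs_cons_neg ha]
    cases l with
    | nil => simp [ha] at h
    | cons c l => exact ih (by simp) (by simpa [List.getLast?_cons_cons] using h)
  · intro a ha _ _
    obtain ⟨t, R, h1, h2⟩ := runs_cons_cons_pos ha hpb m
    simp [h1, h2, joinSegments]
  · intro a c l ha hc ih _ h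
    have h' : ∀ x ∈ (c :: l).getLast?, p x = true := by
      simpa [List.getLast?_cons_cons] using h
    have := ih (by simp) h'
    simp only [List.cons_append] at this ⊢
    rw [runs_cons_cons_neg ha hc, this]
    have hne : runs p (c :: l) ≠ [] :=
      runs_ne_nil (List.getLast_mem (List.cons_ne_nil c l))
        (h' _ (by simp [List.getLast?_eq_some_getLast]))
    obtain ⟨u, U, hu⟩ := List.exists_cons_of_ne_nil hne
    rw [hu, joinSegments]
  · intro a c l t R ha hc _ ih _ h
    have := ih (by simp) (by simpa [List.getLast?_cons_cons] using h)
    simp only [List.cons_append] at this ⊢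
    obtain ⟨t2, R2, h3, h4⟩ := runs_cons_cons_pos ha hc (l ++ b :: m)
    obtain ⟨t1, R1, h1, -⟩ := runs_cons_cons_pos hpb hpb m
    rw [h3, h1] at this
    rw [h4, h1]
    cases R with
    | nil => simp_all [joinSegments]
    | cons r R => simp_all [joinSegments]

theorem runs_append_extendStart {pre l : List (ℕ × Fin h)} (hl : l ≠ [])
    (hpre : ∀ a ∈ pre, p a = true) (h' : pre ≠ [] → ∀ a ∈ l.head?, p a = true) :
    runs p (pre ++ l) = extendStart pre (runs p l) := by
  cases pre with
  | nil => cases h : runs p l <;> simp [extendStart, h]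
  | cons c pre =>
    obtain ⟨b, l, rfl⟩ := List.exists_cons_of_ne_nil hl
    have hb : p b = true := h' (by simp) b (by simp)
    rw [runs_append_joinSegments (by simp) (fun a ha => hpre a (List.mem_of_getLast? ha))
      (b := b) (by simp) hb, runs_eq_singleton (by simp) hpre]
    obtain ⟨t, R, h1, -⟩ := runs_cons_cons_pos hb hb l
    simp [h1, joinSegments, extendStart]

theorem joinSegments_singleton {S : Segment h} (hS : S ≠ []) (suf : List (ℕ × Fin h)) :
    joinSegments S [suf] = extendEnd suf S := by
  induction S with
  | nil => simp at hS
  | cons P S ih =>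
    cases S with
    | nil => simp [joinSegments, extendEnd]
    | cons Q S => simpa [joinSegments, extendEnd] using ih

theorem extendEnd_nil (S : Segment h) : extendEnd [] S = S := by
  induction S with
  | nil => rfl
  | cons P S ih =>
    cases S with
    | nil => simp [extendEnd]
    | cons Q S => simpa [extendEnd] using ih

theorem runs_append_extendEnd {l suf : List (ℕ × Fin h)} (hl : l ≠ [])
    (hsuf : ∀ a ∈ suf, p a = true) (h' : suf ≠ [] → ∀ a ∈ l.getLast?, p a = true) :
    runs p (l ++ suf) = extendEnd suf (runs p l) := by
  cases suf with
  | nil => simp [extendEnd_nil]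
  | cons c suf =>
    have h' := h' (by simp)
    rw [runs_append_joinSegments hl h' (b := c) (by simp) (hsuf c (by simp)),
      runs_eq_singleton (by simp) hsuf, joinSegments_singleton]
    exact runs_ne_nil (List.getLast_mem hl) (h' _ (by simp [List.getLast?_eq_some_getLast hl]))

theorem map_extendStart (f : ℕ × Fin h → ℕ × Fin h) (pre : List (ℕ × Fin h)) (S : Segment h) :
    (extendStart pre S).map (List.map f) = extendStart (pre.map f) (S.map (List.map f)) := by
  cases S <;> simp [extendStart]

theorem map_extendEnd (f : ℕ × Fin h → ℕ × Fin h) (suf : List (ℕ × Fin h)) (S : Segment h) :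
    (extendEnd suf S).map (List.map f) = extendEnd (suf.map f) (S.map (List.map f)) := by
  induction S with
  | nil => rfl
  | cons P S ih =>
    cases S with
    | nil => simp [extendEnd]
    | cons Q S => simpa [extendEnd] using ih

theorem map_joinSegments (f : ℕ × Fin h → ℕ × Fin h) (S T : Segment h) :
    (joinSegments S T).map (List.map f) =
      joinSegments (S.map (List.map f)) (T.map (List.map f)) := by
  induction S with
  | nil => cases T <;> rfl
  | cons P S ih =>
    cases S with
    | nil => cases T <;> simp [joinSegments]
    | cons Q S => simpa [joinSegments] using ih

end Segments

/-! ## Walks seen through a window of columns -/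

section Window

variable {h : ℕ}

/-- Move a point `i` columns to the left. -/
def shift (i : ℕ) (p : ℕ × Fin h) : ℕ × Fin h := (p.1 - i, p.2)

/-- The part of a path in the columns `≥ i`, moved `i` columns to the left. -/
def window (i : ℕ) (P : List (ℕ × Fin h)) : Segment h :=
  (runs (fun p => decide (i ≤ p.1)) P).map (List.map (shift i))

/-- The parts of the paths of `G` in the columns `≤ c`. -/
def restrict (c : ℕ) (G : List (List (ℕ × Fin h))) : List (List (ℕ × Fin h)) :=
  G.flatMap (runs fun p => decide (p.1 ≤ c))

/-! ### Adjacency and shifts of columns -/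

theorem adj_col {a b : ℕ × Fin h} (hab : (grid h).Adj a b) : a.1 ≤ b.1 + 1 ∧ b.1 ≤ a.1 + 1 := by
  rcases hab with ⟨h1, _⟩ | ⟨_, h1⟩ <;> omega

theorem adj_row {a b : ℕ × Fin h} (hab : (grid h).Adj a b) (hne : a.1 ≠ b.1) : a.2 = b.2 := by
  rcases hab with ⟨h1, _⟩ | ⟨h1, _⟩
  · exact absurd h1 hne
  · exact h1

theorem adj_shift {i : ℕ} {a b : ℕ × Fin h} (ha : i ≤ a.1) (hb : i ≤ b.1) :
    (grid h).Adj (shift i a) (shift i b) ↔ (grid h).Adj a b := by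
  simp only [grid, shift]
  have h1 : a.1 - i = b.1 - i ↔ a.1 = b.1 := by omega
  have h2 : a.1 - i + 1 = b.1 - i ↔ a.1 + 1 = b.1 := by omega
  have h3 : b.1 - i + 1 = a.1 - i ↔ b.1 + 1 = a.1 := by omega
  rw [h1, h2, h3]

theorem shift_inj {i : ℕ} {a b : ℕ × Fin h} (ha : i ≤ a.1) (hb : i ≤ b.1)
    (hab : shift i a = shift i b) : a = b := by
  simp only [shift, Prod.mk.injEq] at hab
  exact Prod.ext (by omega) hab.2

/-! ### Points, edges and trimming of windows -/

theorem flatten_window (i : ℕ) (P : List (ℕ × Fin h)) :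
    (window i P).flatten = (P.filter fun p => decide (i ≤ p.1)).map (shift i) := by
  rw [window, ← List.map_flatten, flatten_runs]

theorem vertices_view (i : ℕ) (G : List (List (ℕ × Fin h))) :
    vertices (G.map (window i)) = (G.flatten.filter fun p => decide (i ≤ p.1)).map (shift i) := by
  induction G with
  | nil => rfl
  | cons P G ih =>
    simp only [vertices, List.map_cons, List.flatten_cons, List.flatten_append,
      List.filter_append, List.map_append, flatten_window] at ih ⊢
    rw [ih]

/-- Subtraction in `shift` is truncated, so it is injective only on the columns `≥ i`; the side
condition on both sides accounts for this. -/
theorem mem_vertices_view {i : ℕ} {G : List (List (ℕ × Fin h))} {p : ℕ × Fin h} :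
    shift i p ∈ vertices (G.map (window i)) ∧ i ≤ p.1 ↔ p ∈ G.flatten ∧ i ≤ p.1 := by
  rw [vertices_view]
  constructor
  · rintro ⟨hp, hi⟩
    obtain ⟨q, hq, hqp⟩ := List.mem_map.1 hp
    simp only [List.mem_filter, decide_eq_true_eq] at hq
    exact ⟨shift_inj hq.2 hi hqp ▸ hq.1, hi⟩
  · rintro ⟨hp, hi⟩
    exact ⟨List.mem_map.2 ⟨p, List.mem_filter.2 ⟨hp, by simpa using hi⟩, rfl⟩, hi⟩

theorem pairs_view (i : ℕ) (G : List (List (ℕ × Fin h))) :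
    (G.map (window i)).flatten.flatMap pairs =
      ((G.flatMap pairs).filter fun x => decide (i ≤ x.1.1) && decide (i ≤ x.2.1)).map
        (Prod.map (shift i) (shift i)) := by
  induction G with
  | nil => rfl
  | cons P G ih =>
    rw [List.map_cons, List.flatten_cons, List.flatMap_append, ih, List.flatMap_cons,
      List.filter_append, List.map_append,
      ← flatMap_pairs_runs (p := fun p : ℕ × Fin h => decide (i ≤ p.1)),
      window, List.map_flatMap, List.flatMap_map]
    simp only [pairs_map]

theorem edgeCount_eq (F : List (Segment h)) : edgeCount F = (F.flatten.flatMap pairs).length := by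
  rw [edgeCount, List.length_flatMap]
  simp [length_pairs]

theorem flatten_restrict (c : ℕ) (G : List (List (ℕ × Fin h))) :
    (restrict c G).flatten = G.flatten.filter fun p => decide (p.1 ≤ c) := by
  induction G with
  | nil => rfl
  | cons P G ih =>
    rw [restrict, List.flatMap_cons, List.flatten_append, flatten_runs, List.flatten_cons,
      List.filter_append, ← ih, restrict]

theorem pairs_restrict (c : ℕ) (G : List (List (ℕ × Fin h))) :
    (restrict c G).flatMap pairs =
      (G.flatMap pairs).filter fun x => decide (x.1.1 ≤ c) && decide (x.2.1 ≤ c) := by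
  induction G with
  | nil => rfl
  | cons P G ih =>
    rw [restrict, List.flatMap_cons, List.flatMap_append, List.flatMap_cons, List.filter_append,
      ← flatMap_pairs_runs (p := fun p : ℕ × Fin h => decide (p.1 ≤ c)), ← ih, restrict]

/-- Column `0` of the shifted picture is column `i`; cutting it out of the runs in the columns `≥ i`
gives the runs in the columns `≥ i + 1`. -/
theorem trim_view (i : ℕ) (G : List (List (ℕ × Fin h))) :
    trim (G.map (window i)) = G.map (window (i + 1)) := by
  rw [trim, List.map_map]
  refine List.map_congr_left fun P _ => ?_
  have h1 : ∀ Q : List (ℕ × Fin h),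
      (List.splitOnP (fun p => p.1 == 0) Q).filter (fun P => !P.isEmpty) =
        runs (fun p => !(p.1 == 0)) Q := fun Q => by simp [runs]
  simp only [Function.comp_apply, List.filter_flatMap, h1]
  rw [window, List.flatMap_map]
  have h2 : ((fun p : ℕ × Fin h => !(p.1 == 0)) ∘ shift i) = fun p => decide (i + 1 ≤ p.1) := by
    funext p
    simp only [shift, Function.comp_apply]
    rw [Bool.eq_iff_iff]
    simp
    omega
  simp only [runs_map, h2]
  rw [← List.map_flatMap, flatMap_runs_runs (by simp; omega), List.map_map, window]
  refine List.map_congr_left fun Q _ => ?_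
  simp [shift, Nat.sub_sub]

theorem window_ne_nil {i : ℕ} {P : List (ℕ × Fin h)} {p : ℕ × Fin h} (hp : p ∈ P)
    (hi : i ≤ p.1) : window i P ≠ [] := by
  simpa [window] using runs_ne_nil (p := fun p => decide (i ≤ p.1)) hp (by simpa using hi)

theorem window_eq_singleton {i : ℕ} {P : List (ℕ × Fin h)} (hP : P ≠ []) (hi : ∀ p ∈ P, i ≤ p.1) :
    window i P = [P.map (shift i)] := by
  rw [window, runs_eq_singleton hP (by simpa using hi)]
  rfl

/-- A path can leave the columns `≥ i` only through column `i`. -/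
theorem getLast_filter {i : ℕ} {P : List (ℕ × Fin h)} (hP : P.IsChain (grid h).Adj)
    {e e' : ℕ × Fin h} (he : e ∈ P.getLast?)
    (he' : e' ∈ (P.filter fun p => decide (i ≤ p.1)).getLast?) : e' = e ∨ e'.1 = i := by
  induction P with
  | nil => simp at he
  | cons a P ih =>
    cases P with
    | nil =>
      rw [List.filter_cons] at he'
      split at he' <;> simp_all
    | cons b P =>
      rw [List.isChain_cons_cons] at hP
      rw [List.getLast?_cons_cons] at he
      have ih := ih hP.2 he
      rw [List.filter_cons] at he'
      split at he'
      · rename_i ha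
        cases hf : (b :: P).filter fun p => decide (i ≤ p.1) with
        | nil =>
          rw [hf] at he'
          obtain rfl : a = e' := by simpa using he'
          have hb : ¬ i ≤ b.1 := by
            intro hb
            have : b ∈ (b :: P).filter fun p => decide (i ≤ p.1) := by simp [hb]
            simp [hf] at this
          have := adj_col hP.1
          simp only [decide_eq_true_eq] at ha
          right
          omega
        | cons x t =>
          rw [hf, List.getLast?_cons_cons, ← hf] at he'
          exact ih he'
      · exact ih he'

/-! ### Partial walks and their frames -/

/-- The union of the maximal pieces, in the columns `≤ c`, of a self-avoiding walk from the top-left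
corner that may still grow into a trapped one. -/
structure IsPartialWalk (c : ℕ) (G : List (List (ℕ × Fin h))) : Prop where
  ne_nil : ∀ P ∈ G, P ≠ []
  isChain : ∀ P ∈ G, P.IsChain (grid h).Adj
  nodup : G.flatten.Nodup
  le : ∀ p ∈ G.flatten, p.1 ≤ c
  corner : ∃ p ∈ G.flatten.head?, p.1 = 0 ∧ p.2.val + 1 = h
  link : G.IsChain fun P Q => (∀ e ∈ P.getLast?, e.1 = c) ∧ ∀ s ∈ Q.head?, s.1 = c
  two_le : ∀ P ∈ G.dropLast, 2 ≤ P.length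
  trapped : ∀ e ∈ G.flatten.getLast?, (e.1 < c ∨ G.getLast? = some [e]) →
    ∀ q, (grid h).Adj e q → q.1 ≤ c → q ∈ G.flatten
  exists_col : ∃ p ∈ G.flatten, p.1 = c

theorem IsPartialWalk.pairs_adj {c : ℕ} {G : List (List (ℕ × Fin h))} (hG : IsPartialWalk c G) :
    ∀ x ∈ G.flatMap pairs, (grid h).Adj x.1 x.2 := by
  intro x hx
  obtain ⟨P, hP, hx⟩ := List.mem_flatMap.1 hx
  exact isChain_iff_pairs.1 (hG.isChain P hP) x hx

/-- A path that is not last ends in column `c`, one that is not first starts there, and a lone path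
is covered by `exists_col`. Hence no window of a piece is empty. -/
theorem IsPartialWalk.exists_mem_col {c : ℕ} {G : List (List (ℕ × Fin h))}
    (hG : IsPartialWalk c G) {P : List (ℕ × Fin h)} (hP : P ∈ G) : ∃ p ∈ P, p.1 = c := by
  have hne := hG.ne_nil P hP
  have hl := isChain_and_iff.1 hG.link
  obtain ⟨l, m, rfl⟩ := List.append_of_mem hP
  cases m with
  | nil =>
    cases l with
    | nil => simpa using hG.exists_col
    | cons Q l =>
      exact ⟨P.head hne, List.head_mem hne,
        hl.2 P (by simp) _ (by simp [List.head?_eq_some_head hne])⟩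
  | cons Q m =>
    exact ⟨P.getLast hne, List.getLast_mem hne,
      hl.1 P (by simp) _ (by simp [List.getLast?_eq_some_getLast hne])⟩

theorem IsPartialWalk.isFrame {c i w : ℕ} {G : List (List (ℕ × Fin h))} (hG : IsPartialWalk c G)
    (hi : i ≤ c) (hw : c < i + w) : IsFrame w (G.map (window i)) where
  segment_ne_nil := by
    intro S hS
    obtain ⟨P, hP, rfl⟩ := List.mem_map.1 hS
    obtain ⟨p, hp, hpc⟩ := hG.exists_mem_col hP
    exact window_ne_nil hp (by omega)
  path_ne_nil := by
    intro S hS Q hQ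
    obtain ⟨P, hP, rfl⟩ := List.mem_map.1 hS
    obtain ⟨R, hR, rfl⟩ := List.mem_map.1 hQ
    simpa using ne_nil_of_mem_runs hR
  isChain := by
    intro S hS Q hQ
    rw [isChain_iff_pairs]
    intro x hx
    have : x ∈ (G.map (window i)).flatten.flatMap pairs :=
      List.mem_flatMap.2 ⟨Q, List.mem_flatten.2 ⟨S, hS, hQ⟩, hx⟩
    rw [pairs_view] at this
    obtain ⟨y, hy, rfl⟩ := List.mem_map.1 this
    simp only [List.mem_filter, Bool.and_eq_true, decide_eq_true_eq] at hy
    exact (adj_shift hy.2.1 hy.2.2).2 (hG.pairs_adj y hy.1)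
  nodup := by
    rw [vertices_view]
    refine (hG.nodup.filter _).map_on ?_
    intro a ha b hb
    simp only [List.mem_filter, decide_eq_true_eq] at ha hb
    exact shift_inj ha.2 hb.2
  window := by
    intro p hp
    rw [vertices_view] at hp
    obtain ⟨q, hq, rfl⟩ := List.mem_map.1 hp
    have := hG.le q (List.mem_filter.1 hq).1
    simp only [shift]
    omega

/-- Inclusion–exclusion for two filters that cover the list. -/
theorem length_add_length_filter {α : Type*} {p q : α → Bool} {l : List α}
    (hl : ∀ x ∈ l, p x = true ∨ q x = true) :
    l.length + (l.filter fun x => p x && q x).length =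
      (l.filter p).length + (l.filter q).length := by
  induction l with
  | nil => simp
  | cons a l ih =>
    have ih := ih fun x hx => hl x (List.mem_cons_of_mem _ hx)
    have ha := hl a (by simp)
    cases hp : p a <;> cases hq : q a <;> simp_all <;> omega

/-- The edges gained by a frame are the edges gained by the walk. -/
theorem IsPartialWalk.edgeCount_view {i : ℕ} {G : List (List (ℕ × Fin h))}
    (hG : IsPartialWalk (i + 2) G) :
    (G.flatMap pairs).length + edgeCount ((restrict (i + 1) G).map (window i)) =
      ((restrict (i + 1) G).flatMap pairs).length + edgeCount (G.map (window i)) := by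
  rw [edgeCount_eq, edgeCount_eq, pairs_view, pairs_view, pairs_restrict, List.length_map,
    List.length_map, List.filter_filter, ← length_add_length_filter]
  · simp only [Bool.and_comm]
  · intro x hx
    have := adj_col (hG.pairs_adj x hx)
    simp only [Bool.and_eq_true, decide_eq_true_eq]
    omega

/-- Guarantees that the natural-number subtraction defining the weight of an edge between frames is
not truncated. -/
theorem edgeCount_restrict_le (i c : ℕ) (G : List (List (ℕ × Fin h))) :
    edgeCount ((restrict c G).map (window i)) ≤ edgeCount (G.map (window i)) := by
  rw [edgeCount_eq, edgeCount_eq, pairs_view, pairs_view, pairs_restrict, List.length_map,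
    List.length_map]
  exact (List.Sublist.filter _ List.filter_sublist).length_le

end Window

/-! ## From a longer walk to a shorter one -/

section Restrict

variable {h : ℕ}

/-! ### Cutting one path at its visits to column `c + 1` -/

/-- A path of the columns `≤ c` together with points of column `c + 1` before and behind it. -/
structure Piece (h : ℕ) where
  pre : List (ℕ × Fin h)
  body : List (ℕ × Fin h)
  suf : List (ℕ × Fin h)

/-- The whole path of a piece. -/
def Piece.path (b : Piece h) : List (ℕ × Fin h) := b.pre ++ (b.body ++ b.suf)

/-- The columns of the three parts of a piece. -/
structure Piece.Wf (c : ℕ) (b : Piece h) : Prop where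
  ne_nil : b.body ≠ []
  body_le : ∀ x ∈ b.body, x.1 ≤ c
  pre_eq : ∀ x ∈ b.pre, x.1 = c + 1
  suf_eq : ∀ x ∈ b.suf, x.1 = c + 1
  head_eq : b.pre ≠ [] → ∀ x ∈ b.body.head?, x.1 = c
  last_eq : b.suf ≠ [] → ∀ x ∈ b.body.getLast?, x.1 = c

/-- The points at both junctions lie in column `c` or `c + 1`, hence in the window, so no cut falls
at a junction. -/
theorem Piece.window_path {i c : ℕ} {b : Piece h} (hb : b.Wf c) (hi : i ≤ c) :
    window i b.path =
      extendEnd (b.suf.map (shift i)) (extendStart (b.pre.map (shift i)) (window i b.body)) := by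
  have h1 : runs (fun p => decide (i ≤ p.1)) b.path =
      extendEnd b.suf (extendStart b.pre (runs (fun p => decide (i ≤ p.1)) b.body)) := by
    rw [Piece.path, ← List.append_assoc, runs_append_extendEnd, runs_append_extendStart hb.ne_nil]
    · intro x hx
      simp [hb.pre_eq x hx]
      omega
    · intro hne x hx
      simp [hb.head_eq hne x hx, hi]
    · simp [hb.ne_nil]
    · intro x hx
      simp [hb.suf_eq x hx]
      omega
    · intro hne x hx
      rw [List.getLast?_append_of_ne_nil _ hb.ne_nil] at hx
      simp [hb.last_eq hne x hx, hi]
  rw [window, h1, map_extendEnd, map_extendStart, window]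

theorem adj_eq_col {c : ℕ} {a b : ℕ × Fin h} (hab : (grid h).Adj a b) (ha : a.1 = c + 1)
    (hb : b.1 ≤ c) : b = (c, a.2) := by
  have h1 := adj_col hab
  exact Prod.ext (by simp only; omega) (adj_row hab (by omega)).symm

/-- An excursion into column `c + 1` between two visits to the columns `≤ c` has at least two
points, for a single point would be left and entered through the same left neighbour. It can
therefore be shared between a nonempty `suf` and the nonempty `pre` of the next piece. -/
theorem exists_pieces (c : ℕ) {Q : List (ℕ × Fin h)} (hQ : Q.IsChain (grid h).Adj)
    (hnd : Q.Nodup) (hle : ∀ x ∈ Q, x.1 ≤ c + 1) (hex : ∃ x ∈ Q, x.1 ≤ c) :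
    ∃ B : List (Piece h), B ≠ [] ∧ (B.map Piece.path).flatten = Q ∧
      (∀ b ∈ B, b.body ≠ [] ∧ (∀ x ∈ b.body, x.1 ≤ c) ∧ (∀ x ∈ b.pre, x.1 = c + 1) ∧
        ∀ x ∈ b.suf, x.1 = c + 1) ∧
      B.map Piece.body = runs (fun p => decide (p.1 ≤ c)) Q ∧
      B.IsChain fun b b' => b.suf ≠ [] ∧ b'.pre ≠ [] := by
  induction Q with
  | nil => simp at hex
  | cons x Q ih =>
    have hle' : ∀ x ∈ Q, x.1 ≤ c + 1 := fun y hy => hle y (List.mem_cons_of_mem _ hy)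
    have hx1 := hle x (by simp)
    by_cases hQ' : ∃ y ∈ Q, y.1 ≤ c
    · obtain ⟨B, hB, hflat, hwf, hbody, hlink⟩ := ih hQ.tail (List.nodup_cons.1 hnd).2 hle' hQ'
      obtain ⟨⟨pre, body, suf⟩, B, rfl⟩ := List.exists_cons_of_ne_nil hB
      simp only [List.map_cons, List.flatten_cons, Piece.path] at hflat hbody
      rw [List.forall_mem_cons] at hwf
      obtain ⟨⟨hne, hb1, hb2, hb3⟩, hwf⟩ := hwf
      simp only at hne hb1 hb2 hb3
      by_cases hx : x.1 ≤ c
      · obtain ⟨z, body, rfl⟩ := List.exists_cons_of_ne_nil hne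
        have hz := hb1 z (by simp)
        -- With no point of column `c + 1` between `x` and the next body, `x` joins that body; one
        -- such point is impossible; two or more form an excursion.
        obtain _ | ⟨y, _ | ⟨y', pre⟩⟩ := pre
        · subst hflat
          refine ⟨⟨[], x :: z :: body, suf⟩ :: B, by simp, by simp [Piece.path],
            List.forall_mem_cons.2 ⟨⟨by simp, List.forall_mem_cons.2 ⟨hx, hb1⟩, by simp, hb3⟩, hwf⟩,
            ?_, ?_⟩
          · simp only [List.nil_append, List.cons_append, List.map_cons] at hbody ⊢
            obtain ⟨t, R, h1, h2⟩ := runs_cons_cons_pos (p := fun p : ℕ × Fin h => decide (p.1 ≤ c))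
              (a := x) (b := z) (by simpa using hx) (by simpa using hz)
              (body ++ suf ++ (B.map Piece.path).flatten)
            rw [h1] at hbody
            rw [h2]
            simpa using hbody
          · cases B with
            | nil => simp
            | cons b B => simpa using hlink
        · exfalso
          subst hflat
          simp only [List.cons_append, List.nil_append, List.isChain_cons_cons] at hQ
          have hy := hb2 y (by simp)
          have e1 := adj_eq_col hQ.1.symm hy hx
          have e2 := adj_eq_col hQ.2.1 hy hz
          simp [e1, e2] at hnd
        · have hy := hb2 y (by simp)
          subst hflat
          -- The place where the excursion is split is arbitrary; here its first point becomes the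
          -- suffix of the new piece.
          refine ⟨⟨[], [x], [y]⟩ :: ⟨y' :: pre, z :: body, suf⟩ :: B, by simp, by simp [Piece.path],
            List.forall_mem_cons.2 ⟨⟨by simp, by simpa using hx, by simp, by simpa using hy⟩,
              List.forall_mem_cons.2 ⟨⟨by simp, hb1,
                fun w hw => hb2 w (List.mem_cons_of_mem _ hw), hb3⟩, hwf⟩⟩, ?_, ?_⟩
          · simp only [List.cons_append, List.map_cons] at hbody ⊢
            rw [runs_cons_cons_neg (by simpa using hx) (by simp; omega), ← hbody]
          · cases B with
            | nil => simp
            | cons b B => simpa using hlink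
      · refine ⟨⟨x :: pre, body, suf⟩ :: B, by simp, by simp [Piece.path, ← hflat],
            List.forall_mem_cons.2 ⟨⟨hne, hb1, List.forall_mem_cons.2 ⟨by omega, hb2⟩,
              hb3⟩, hwf⟩, ?_, ?_⟩
        · rw [runs_cons_neg (by simpa using hx), ← hbody]
          rfl
        · cases B with
            | nil => simp
            | cons b B => simpa using hlink
    · have hx : x.1 ≤ c := by
        obtain ⟨y, hy, hyc⟩ := hex
        rcases List.mem_cons.1 hy with rfl | hy
        · exact hyc
        · exact absurd ⟨y, hy, hyc⟩ hQ'
      push Not at hQ'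
      refine ⟨[⟨[], [x], Q⟩], by simp, by simp [Piece.path], ?_, ?_, by simp⟩
      · simp only [List.mem_singleton, forall_eq]
        exact ⟨by simp, by simpa using hx, by simp,
          fun y hy => le_antisymm (hle' y hy) (hQ' y hy)⟩
      · rw [← List.singleton_append (x := x) (l := Q), runs_append,
          runs_singleton (by simpa using hx),
          runs_eq_nil (l := Q)]
        · rfl
        · intro y hy
          simpa using hQ' y hy
        · right
          intro y hy
          simpa using hQ' y (List.mem_of_mem_head? hy)

/-- A step between column `c + 1` and the columns `≤ c` can only use column `c`. -/
theorem Piece.wf_of_isChain {c : ℕ} {b : Piece h} (hne : b.body ≠ []) (hb : ∀ x ∈ b.body, x.1 ≤ c)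
    (hp : ∀ x ∈ b.pre, x.1 = c + 1) (hs : ∀ x ∈ b.suf, x.1 = c + 1)
    (hch : b.path.IsChain (grid h).Adj) : b.Wf c := by
  rw [isChain_iff_pairs] at hch
  refine ⟨hne, hb, hp, hs, fun hpre x hx => ?_, fun hsuf x hx => ?_⟩
  · have := hch (b.pre.getLast hpre, x) (mem_pairs_append
      (by simp [List.getLast?_eq_some_getLast hpre])
      (by rw [List.head?_append_of_ne_nil _ hne]; exact hx))
    rw [show x = _ from adj_eq_col this (hp _ (List.getLast_mem hpre))
      (hb x (List.mem_of_mem_head? hx))]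
  · have := hch (x, b.suf.head hsuf) (mem_pairs_append_right (mem_pairs_append hx
      (by simp [List.head?_eq_some_head hsuf])))
    rw [show x = _ from adj_eq_col this.symm (hs _ (List.head_mem hsuf))
      (hb x (List.mem_of_getLast? hx))]

/-- A piece of a self-avoiding walk that comes from column `c + 1` and returns to it has at least
two points in the columns `≤ c`. -/
theorem Piece.two_le {c : ℕ} {b : Piece h} (hb : b.Wf c) (hch : b.path.IsChain (grid h).Adj)
    (hnd : b.path.Nodup) (hpre : b.pre ≠ []) (hsuf : b.suf ≠ []) : 2 ≤ b.body.length := by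
  by_contra hlt
  obtain ⟨x, hx⟩ : ∃ x, b.body = [x] := by
    rw [← List.length_eq_one_iff]
    have := List.length_pos_iff.2 hb.ne_nil
    omega
  have hxc := hb.body_le x (by simp [hx])
  rw [isChain_iff_pairs] at hch
  have h1 := hch (b.pre.getLast hpre, x) (mem_pairs_append
      (by simp [List.getLast?_eq_some_getLast hpre]) (by simp [hx]))
  have h2 := hch (x, b.suf.head hsuf) (mem_pairs_append_right (mem_pairs_append (by simp [hx])
      (by simp [List.head?_eq_some_head hsuf])))
  have c1 := hb.pre_eq _ (List.getLast_mem hpre)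
  have c2 := hb.suf_eq _ (List.head_mem hsuf)
  have r1 := adj_row h1 (by simp only; omega)
  have r2 := adj_row h2 (by simp only; omega)
  have e : b.pre.getLast hpre = b.suf.head hsuf :=
    Prod.ext (c1.trans c2.symm) (r1.trans r2)
  rw [Piece.path, List.nodup_append] at hnd
  exact hnd.2.2 _ (List.getLast_mem hpre) _ (List.mem_append_right _ (List.head_mem hsuf)) e

theorem window_append {i : ℕ} {P Q : List (ℕ × Fin h)} (hP : P ≠ []) (hQ : Q ≠ [])
    (hl : ∀ e ∈ P.getLast?, i ≤ e.1) (hh : ∀ s ∈ Q.head?, i ≤ s.1) :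
    window i (P ++ Q) = joinSegments (window i P) (window i Q) := by
  rw [window, runs_append_joinSegments hP (by simpa using hl)
    (b := Q.head hQ) (by simp [List.head?_eq_some_head hQ])
    (by simpa using hh _ (by simp [List.head?_eq_some_head hQ])), map_joinSegments]
  rfl

theorem Merges.eq_nil {L : List (Segment h)} (hL : Merges L []) : L = [] := by
  generalize hM : ([] : List (Segment h)) = M at hL
  induction hL with
  | nil => rfl
  | keep _ _ => simp at hM
  | join _ ih => exact absurd ((ih hM).trans hM.symm) (by simp)

/-- The first two paths are fused into one longer first path, and the induction continues with a
shorter list. -/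
theorem merges_window {i : ℕ} {P : List (ℕ × Fin h)} {L : List (List (ℕ × Fin h))}
    (hP : P ≠ []) (hL : ∀ Q ∈ L, Q ≠ [])
    (hlink : (P :: L).IsChain fun P Q => (∀ e ∈ P.getLast?, i ≤ e.1) ∧ ∀ s ∈ Q.head?, i ≤ s.1)
    {M M' : List (Segment h)} (hM : Merges M M') :
    Merges ((P :: L).map (window i) ++ M) (window i (P :: L).flatten :: M') := by
  induction L generalizing P with
  | nil => simpa using Merges.keep hM
  | cons Q L ih =>
    rw [List.isChain_cons_cons] at hlink
    have hQ : Q ≠ [] := hL Q (by simp)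
    simp only [List.map_cons, List.cons_append]
    refine Merges.join ?_
    rw [← window_append hP hQ hlink.1.1 hlink.1.2]
    have := ih (P := P ++ Q) (by simp [hP]) (fun R hR => hL R (by simp [hR])) ?_
    · simpa using this
    · cases L with
      | nil => simp
      | cons R L =>
        rw [List.isChain_cons_cons] at hlink ⊢
        rw [List.getLast?_append_of_ne_nil _ hQ]
        exact hlink.2

/-! ### Decomposing all paths of a partial walk -/

/-- The list `B` of pieces is the decomposition of the paths of `T`. -/
structure IsDecomposition (c : ℕ) (T : List (List (ℕ × Fin h))) (B : List (Piece h)) : Prop where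
  body : B.map Piece.body = restrict c T
  wf : ∀ b ∈ B, b.Wf c
  isChain : ∀ b ∈ B, b.path.IsChain (grid h).Adj
  nodup : ∀ b ∈ B, b.path.Nodup
  link : B.IsChain fun b b' => b.suf ≠ [] ∧ b'.pre ≠ []
  last : ∀ b ∈ B.getLast?, b.suf = [] → b.body.getLast? = T.flatten.getLast?

theorem exists_isDecomposition (c : ℕ) {Q : List (ℕ × Fin h)} (hQ : Q.IsChain (grid h).Adj)
    (hnd : Q.Nodup) (hle : ∀ x ∈ Q, x.1 ≤ c + 1) (hex : ∃ x ∈ Q, x.1 ≤ c) :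
    ∃ B : List (Piece h), B ≠ [] ∧ (B.map Piece.path).flatten = Q ∧ IsDecomposition c [Q] B := by
  obtain ⟨B, hB, hflat, hwf, hbody, hlink⟩ := exists_pieces c hQ hnd hle hex
  have hinf : ∀ b ∈ B, b.path <:+: Q := by
    intro b hb
    obtain ⟨l, m, rfl⟩ := List.append_of_mem hb
    exact ⟨(l.map Piece.path).flatten, (m.map Piece.path).flatten, by simp [← hflat]⟩
  refine ⟨B, hB, hflat, ⟨by simp [restrict, hbody], fun b hb => ?_,
    fun b hb => hQ.infix (hinf b hb),
    fun b hb => hnd.sublist (hinf b hb).sublist, hlink, fun b hb hs => ?_⟩⟩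
  · exact Piece.wf_of_isChain (hwf b hb).1 (hwf b hb).2.1 (hwf b hb).2.2.1 (hwf b hb).2.2.2
      (hQ.infix (hinf b hb))
  · have hne := (hwf b (List.mem_of_getLast? hb)).1
    obtain ⟨l, rfl⟩ := List.getLast?_eq_some_iff.1 hb
    rw [List.flatten_singleton, ← hflat]
    simp only [List.map_append, List.map_cons, List.map_nil, List.flatten_append,
      List.flatten_singleton, Piece.path, hs, List.append_nil]
    rw [← List.append_assoc, List.getLast?_append_of_ne_nil _ hne]

theorem Piece.path_ne_nil {c : ℕ} {b : Piece h} (hb : b.Wf c) : b.path ≠ [] := by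
  simp [Piece.path, hb.ne_nil]

theorem Piece.getLast_path {c : ℕ} {b : Piece h} (hb : b.Wf c) (hs : b.suf ≠ []) :
    ∀ e ∈ b.path.getLast?, e.1 = c + 1 := by
  intro e he
  rw [Piece.path, ← List.append_assoc, List.getLast?_append_of_ne_nil _ hs] at he
  exact hb.suf_eq e (List.mem_of_getLast? he)

theorem Piece.head_path {c : ℕ} {b : Piece h} (hb : b.Wf c) (hs : b.pre ≠ []) :
    ∀ e ∈ b.path.head?, e.1 = c + 1 := by
  intro e he
  rw [Piece.path, List.head?_append_of_ne_nil _ hs] at he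
  exact hb.pre_eq e (List.mem_of_mem_head? he)

/-- Bodies stay in the columns `≤ c`, so an end in column `c + 1` cannot belong to the last body. -/
theorem IsDecomposition.suf_ne_nil {c : ℕ} {T : List (List (ℕ × Fin h))} {B : List (Piece h)}
    (hB : IsDecomposition c T B) (hT : ∀ e ∈ T.flatten.getLast?, e.1 = c + 1) :
    ∀ b ∈ B.getLast?, b.suf ≠ [] := by
  intro b hb hs
  have hw := hB.wf b (List.mem_of_getLast? hb)
  have := hB.last b hb hs
  rw [List.getLast?_eq_some_getLast hw.ne_nil] at this
  have h1 := hT _ this.symm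
  have h2 := hw.body_le _ (List.getLast_mem hw.ne_nil)
  omega

theorem IsDecomposition.append {c : ℕ} {Q : List (ℕ × Fin h)} {T : List (List (ℕ × Fin h))}
    {B B' : List (Piece h)} (hB : IsDecomposition c [Q] B) (hB' : IsDecomposition c T B')
    (hT : ∀ P ∈ T, P ≠ []) (hQ : T ≠ [] → ∀ e ∈ Q.getLast?, e.1 = c + 1)
    (hpre : ∀ b ∈ B', b.pre ≠ []) : IsDecomposition c (Q :: T) (B ++ B') := by
  have hTB : B' ≠ [] → T ≠ [] := by
    rintro h rfl
    exact h (by simpa [restrict] using hB'.body)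
  refine ⟨?_, ?_, ?_, ?_, ?_, ?_⟩
  · simp only [List.map_append, hB.body, hB'.body, restrict, List.flatMap_cons, List.flatMap_nil,
      List.append_nil]
  · simpa only [List.forall_mem_append] using ⟨hB.wf, hB'.wf⟩
  · simpa only [List.forall_mem_append] using ⟨hB.isChain, hB'.isChain⟩
  · simpa only [List.forall_mem_append] using ⟨hB.nodup, hB'.nodup⟩
  · refine List.isChain_append.2 ⟨hB.link, hB'.link, fun x hx y hy => ⟨?_, ?_⟩⟩
    · exact hB.suf_ne_nil (by simpa using hQ (hTB (by rintro rfl; simp at hy))) x hx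
    · exact hpre y (List.mem_of_mem_head? hy)
  · intro b hb hs
    by_cases hB0 : B' = []
    · subst hB0
      rw [List.append_nil] at hb
      by_cases hT0 : T = []
      · subst hT0
        exact hB.last b hb hs
      · exact absurd hs (hB.suf_ne_nil (by simpa using hQ hT0) b hb)
    · rw [List.getLast?_append_of_ne_nil _ hB0] at hb
      rw [hB'.last b hb hs, List.flatten_cons, List.getLast?_append_of_ne_nil]
      obtain ⟨P, T, rfl⟩ := List.exists_cons_of_ne_nil (hTB hB0)
      simp [hT P (by simp)]

theorem IsDecomposition.merges {c i : ℕ} {Q : List (ℕ × Fin h)} {B : List (Piece h)} (hi : i ≤ c)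
    (hB : IsDecomposition c [Q] B) (hne : B ≠ []) (hflat : (B.map Piece.path).flatten = Q)
    {M M' : List (Segment h)} (hM : Merges M M') :
    Merges (B.map (fun b => window i b.path) ++ M) (window i Q :: M') := by
  obtain ⟨b, B, rfl⟩ := List.exists_cons_of_ne_nil hne
  have := merges_window (i := i) (P := b.path) (L := B.map Piece.path)
    (Piece.path_ne_nil (hB.wf b (by simp))) ?_ ?_ hM
  · simpa [← hflat, Function.comp_def] using this
  · intro P hP
    obtain ⟨b', hb', rfl⟩ := List.mem_map.1 hP
    exact Piece.path_ne_nil (hB.wf b' (by simp [hb']))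
  · rw [← List.map_cons (f := Piece.path), List.isChain_map]
    refine hB.link.imp_of_mem_imp fun x y hx hy hxy => ⟨fun e he => ?_, fun e he => ?_⟩
    · rw [Piece.getLast_path (hB.wf x hx) hxy.1 e he]; omega
    · rw [Piece.head_path (hB.wf y hy) hxy.2 e he]; omega

/-- Paths inside column `i + 2` become inserted segments, and the others are merged from their
pieces. The condition for inserting behind all old segments refers to the last piece of the whole
walk, which may precede `T`; it is kept as an arbitrary `q` implied by either possible location of
that piece, so that it stays fixed in the induction. -/
theorem exists_decomposition_tail {i : ℕ} {T : List (List (ℕ × Fin h))} (hne : ∀ P ∈ T, P ≠ [])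
    (hch : ∀ P ∈ T, P.IsChain (grid h).Adj) (hnd : T.flatten.Nodup)
    (hle : ∀ p ∈ T.flatten, p.1 ≤ i + 2) (hhead : ∀ P ∈ T, ∀ s ∈ P.head?, s.1 = i + 2)
    (hlast : ∀ P ∈ T.dropLast, ∀ e ∈ P.getLast?, e.1 = i + 2)
    (htwo : ∀ P ∈ T.dropLast, 2 ≤ P.length) :
    ∃ B, IsDecomposition (i + 1) T B ∧ (∀ b ∈ B, b.pre ≠ []) ∧
      ∀ q : Prop, (T ≠ [] → B = [] → q) → ((∃ b ∈ B.getLast?, b.suf ≠ []) → q) →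
        ∃ L, Merges (B.map fun b => window i b.path) L ∧ Inserts q L (T.map (window i)) := by
  induction T with
  | nil =>
    exact ⟨[], ⟨by simp [restrict], by simp, by simp, by simp, by simp, by simp⟩, by simp,
      fun q _ _ => ⟨[], Merges.nil, Inserts.nil⟩⟩
  | cons Q T ih =>
    rw [List.forall_mem_cons] at hne hch hhead
    rw [List.flatten_cons, List.nodup_append] at hnd
    rw [List.flatten_cons, List.forall_mem_append] at hle
    have hdrop : ∀ P ∈ T.dropLast, P ∈ (Q :: T).dropLast := by
      intro P hP
      cases T with
      | nil => simp at hP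
      | cons R T => rw [List.dropLast_cons_cons]; exact List.mem_cons_of_mem _ hP
    have hQdrop : T ≠ [] → Q ∈ (Q :: T).dropLast := by
      intro hT
      obtain ⟨R, T, rfl⟩ := List.exists_cons_of_ne_nil hT
      simp
    obtain ⟨B', hB', hpre', hM'⟩ := ih hne.2 hch.2 hnd.2.1 hle.2 hhead.2
      (fun P hP => hlast P (hdrop P hP)) (fun P hP => htwo P (hdrop P hP))
    by_cases hex : ∃ x ∈ Q, x.1 ≤ i + 1
    · obtain ⟨B, hB, hflat, hdec⟩ := exists_isDecomposition (i + 1) hch.1 hnd.1 hle.1 hex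
      have hQ := fun hT => hlast Q (hQdrop hT)
      have happ := hdec.append hB' hne.2 hQ hpre'
      have hpre : ∀ b ∈ B ++ B', b.pre ≠ [] := by
        obtain ⟨b, B, rfl⟩ := List.exists_cons_of_ne_nil hB
        rw [List.cons_append, List.forall_mem_cons]
        refine ⟨?_, fun b' hb' => (isChain_and_iff.1 happ.link).2 b' (by simpa using hb')⟩
        -- Without a prefix the path would start in the columns `≤ i + 1`.
        intro hb
        have hw := hdec.wf b (by simp)
        obtain ⟨z, t, hz⟩ := List.exists_cons_of_ne_nil hw.ne_nil
        have h1 := hhead.1 z (by simp [← hflat, Piece.path, hb, hz])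
        have h2 := hw.body_le z (by simp [hz])
        omega
      refine ⟨B ++ B', happ, hpre, fun q _ hq2 => ?_⟩
      have hM := hM' q ?_ ?_
      · obtain ⟨L, hL, hI⟩ := hM
        refine ⟨window i Q :: L, ?_, Inserts.old hI⟩
        rw [List.map_append]
        exact hdec.merges (by omega) hB hflat hL
      · rintro hT rfl
        refine hq2 ⟨B.getLast hB, by simp [List.getLast?_eq_some_getLast hB], ?_⟩
        exact hdec.suf_ne_nil (by simpa using hQ hT) _ (by simp [List.getLast?_eq_some_getLast hB])
      · rintro ⟨b, hb, hs⟩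
        refine hq2 ⟨b, ?_, hs⟩
        rw [List.getLast?_append_of_ne_nil]
        · exact hb
        · rintro rfl
          simp at hb
    -- The path stays in column `i + 2`: it has no body and is a new segment.
    · push Not at hex
      have hcol : ∀ x ∈ Q, x.1 = i + 2 := fun x hx => le_antisymm (hle.1 x hx) (hex x hx)
      have hr : restrict (i + 1) (Q :: T) = restrict (i + 1) T := by
        rw [restrict, List.flatMap_cons, runs_eq_nil]
        · rfl
        · intro x hx
          simpa using hex x hx
      refine ⟨B', ⟨hr ▸ hB'.body, hB'.wf, hB'.isChain, hB'.nodup, hB'.link, ?_⟩, hpre', ?_⟩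
      · intro b hb hs
        have hT : T ≠ [] := by
          rintro rfl
          have : B' = [] := by simpa [restrict] using hB'.body
          simp [this] at hb
        rw [hB'.last b hb hs, List.flatten_cons, List.getLast?_append_of_ne_nil]
        obtain ⟨P, T, rfl⟩ := List.exists_cons_of_ne_nil hT
        simp [hne.2 P (by simp)]
      · intro q hq1 hq2
        obtain ⟨L, hL, hI⟩ := hM' q (fun _ => hq1 (by simp)) hq2
        refine ⟨L, hL, ?_⟩
        rw [List.map_cons, window_eq_singleton hne.1 (fun p hp => by rw [hcol p hp]; omega)]
        refine Inserts.new ?_ ?_ ?_ hI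
        · intro p hp
          obtain ⟨x, hx, rfl⟩ := List.mem_map.1 hp
          simp [shift, hcol x hx]
        · intro hT
          simpa using htwo Q (hQdrop (by simpa using hT))
        · rintro rfl
          exact hq1 (by simp) (by simpa using hL.eq_nil)

theorem startsIn_window {i k : ℕ} {P : List (ℕ × Fin h)} (hP : P ≠ [])
    (hs : ∀ s ∈ P.head?, s.1 = i + k) : StartsIn k (window i P) := by
  obtain ⟨a, P, rfl⟩ := List.exists_cons_of_ne_nil hP
  have ha := hs a (by simp)
  refine ⟨shift i a, ?_, by simp [shift, ha]⟩
  rw [flatten_window, List.filter_cons_of_pos (by simp [ha])]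
  simp

theorem endsIn_window {i k : ℕ} {P : List (ℕ × Fin h)} (hP : P ≠ [])
    (hs : ∀ s ∈ P.getLast?, s.1 = i + k) : EndsIn k (window i P) := by
  obtain ⟨P, a, rfl⟩ := List.eq_nil_or_concat' P |>.resolve_left hP
  have ha := hs a (by simp)
  refine ⟨shift i a, ?_, by simp [shift, ha]⟩
  rw [flatten_window]
  simp [ha]

theorem IsPartialWalk.ne_empty {c : ℕ} {G : List (List (ℕ × Fin h))} (hG : IsPartialWalk c G) :
    G ≠ [] := by
  rintro rfl
  simpa using hG.exists_col

/-- The first path is treated apart. It starts at the corner, so it has a body, its first piece has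
no prefix, and its segment is never a new one. -/
theorem IsPartialWalk.exists_decomposition {i : ℕ} {G : List (List (ℕ × Fin h))}
    (hG : IsPartialWalk (i + 2) G) :
    ∃ B, IsDecomposition (i + 1) G B ∧ B ≠ [] ∧ (∀ b ∈ B.head?, b.pre = []) ∧
      (∃ p ∈ (restrict (i + 1) G).flatten, p.1 = i + 1) ∧
      ∃ S L X', Merges (B.map fun b => window i b.path) (S :: L) ∧
        Inserts (∃ b ∈ B.getLast?, b.suf ≠ []) L X' ∧ G.map (window i) = S :: X' := by
  obtain ⟨Q, T, rfl⟩ := List.exists_cons_of_ne_nil hG.ne_empty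
  have hl := isChain_and_iff.1 hG.link
  have hne := List.forall_mem_cons.1 hG.ne_nil
  have hch := List.forall_mem_cons.1 hG.isChain
  have hnd := hG.nodup
  rw [List.flatten_cons, List.nodup_append] at hnd
  have hle := hG.le
  rw [List.flatten_cons, List.forall_mem_append] at hle
  obtain ⟨x, hx, hx0, -⟩ := hG.corner
  rw [List.flatten_cons, List.head?_append_of_ne_nil _ hne.1] at hx
  have hdrop : ∀ P ∈ T.dropLast, P ∈ (Q :: T).dropLast := by
    intro P hP
    cases T with
    | nil => simp at hP
    | cons R T => rw [List.dropLast_cons_cons]; exact List.mem_cons_of_mem _ hP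
  have hQ : T ≠ [] → ∀ e ∈ Q.getLast?, e.1 = i + 2 := by
    intro hT
    obtain ⟨R, T, rfl⟩ := List.exists_cons_of_ne_nil hT
    exact hl.1 Q (by simp)
  obtain ⟨B', hB', hpre', hM'⟩ := exists_decomposition_tail hne.2 hch.2 hnd.2.1 hle.2 hl.2
      (fun P hP => hl.1 P (hdrop P hP)) (fun P hP => hG.two_le P (hdrop P hP))
  obtain ⟨B, hB, hflat, hdec⟩ := exists_isDecomposition (i + 1) hch.1 hnd.1 hle.1
    ⟨x, List.mem_of_mem_head? hx, by omega⟩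
  have happ := hdec.append hB' hne.2 hQ hpre'
  refine ⟨B ++ B', happ, by simp [hB], ?_, ?_, ?_⟩
  · obtain ⟨b, B, rfl⟩ := List.exists_cons_of_ne_nil hB
    intro b' hb'
    obtain rfl : b = b' := by simpa using hb'
    by_contra hb
    obtain ⟨y, t, hy⟩ := List.exists_cons_of_ne_nil hb
    have h1 := (hdec.wf b (by simp)).pre_eq y (by simp [hy])
    have h2 : y = x := by simpa [← hflat, Piece.path, hy] using hx
    rw [h2] at h1
    omega
  · obtain ⟨b, B, rfl⟩ := List.exists_cons_of_ne_nil hB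
    have hw := hdec.wf b (by simp)
    -- A first piece without suffix would be the entire partial walk, which then misses column `i +
    -- 2`. With a suffix, its body ends in column `i + 1`.
    by_cases hs : b.suf = []
    · exfalso
      obtain rfl : B = [] := by
        cases B with
        | nil => rfl
        | cons b' B => exact absurd hs (List.isChain_cons_cons.1 hdec.link).1.1
      obtain rfl : T = [] := by
        by_contra hT
        exact hdec.suf_ne_nil (by simpa using hQ hT) b (by simp) hs
      obtain ⟨p, hp, hpc⟩ := hG.exists_col
      simp only [List.flatten_singleton, ← hflat, List.map_cons, List.map_nil, Piece.path,
        hs, List.append_nil, List.mem_append] at hp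
      rcases hp with hp | hp
      · obtain ⟨y, t, hy⟩ := List.exists_cons_of_ne_nil (List.ne_nil_of_mem hp)
        have h1 := hw.pre_eq y (by simp [hy])
        have h2 : y = x := by simpa [← hflat, Piece.path, hy] using hx
        rw [h2] at h1
        omega
      · have := hw.body_le p hp
        omega
    · refine ⟨b.body.getLast hw.ne_nil, ?_, hw.last_eq hs _
        (by simp [List.getLast?_eq_some_getLast hw.ne_nil])⟩
      rw [← happ.body]
      exact List.mem_flatten.2 ⟨b.body, by simp, List.getLast_mem _⟩
  · have hM := hM' (∃ b ∈ (B ++ B').getLast?, b.suf ≠ []) ?_ ?_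
    · obtain ⟨L, hL, hI⟩ := hM
      refine ⟨window i Q, L, T.map (window i), ?_, hI, by simp⟩
      rw [List.map_append]
      exact hdec.merges (by omega) hB hflat hL
    · rintro hT rfl
      refine ⟨B.getLast hB, by simp [List.getLast?_eq_some_getLast hB], ?_⟩
      exact hdec.suf_ne_nil (by simpa using hQ hT) _ (by simp [List.getLast?_eq_some_getLast hB])
    · rintro ⟨b, hb, hs⟩
      refine ⟨b, ?_, hs⟩
      rw [List.getLast?_append_of_ne_nil]
      · exact hb
      · rintro rfl
        simp at hb

/-- The bodies of the decomposition are the new pieces. The delicate conditions are trapping and the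
lower bound on lengths: a body followed by a suffix has at least two points, so trapping is demanded
only when the new end is also the end of the longer walk. -/
theorem IsPartialWalk.restrict_columns {i : ℕ} {G : List (List (ℕ × Fin h))}
    (hG : IsPartialWalk (i + 2) G) : IsPartialWalk (i + 1) (restrict (i + 1) G) := by
  obtain ⟨B, hB, hne, hpre, hcol, -⟩ := hG.exists_decomposition
  have hl := isChain_and_iff.1 hB.link
  have hinf : ∀ b : Piece h, b.body <:+: b.path := fun b => ⟨b.pre, b.suf, by simp [Piece.path]⟩
  have hcorner : ∃ p ∈ (restrict (i + 1) G).flatten.head?, p.1 = 0 ∧ p.2.val + 1 = h := by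
    obtain ⟨p, hp, hp0, hph⟩ := hG.corner
    obtain ⟨t, ht⟩ := List.head?_eq_some_iff.1 hp
    exact ⟨p, by rw [flatten_restrict, ht, List.filter_cons_of_pos (by simp [hp0])]; simp, hp0, hph⟩
  have hhead : ∀ b ∈ B.head?, ∃ p ∈ b.body.head?, p.1 = 0 := by
    intro b hb
    obtain ⟨t, rfl⟩ := List.head?_eq_some_iff.1 hb
    obtain ⟨p, hp, hp0, -⟩ := hcorner
    rw [← hB.body, List.map_cons, List.flatten_cons,
      List.head?_append_of_ne_nil _ (hB.wf b (by simp)).ne_nil] at hp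
    exact ⟨p, hp, hp0⟩
  have hpre' : ∀ b ∈ B, b.pre = [] → b ∈ B.head? := by
    intro b hb hbp
    obtain ⟨b', B, rfl⟩ := List.exists_cons_of_ne_nil hne
    rcases List.mem_cons.1 hb with rfl | hb
    · simp
    · exact absurd hbp (hl.2 b hb)
  -- The first body runs from column `0` to column `i + 1`; any other body has a prefix and falls
  -- under `Piece.two_le`.
  have htwo : ∀ b ∈ B, b.suf ≠ [] → 2 ≤ b.body.length := by
    intro b hb hs
    have hw := hB.wf b hb
    by_cases hp : b.pre = []
    · obtain ⟨p, hp, hp0⟩ := hhead b (hpre' b hb hp)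
      obtain ⟨t, ht⟩ := List.head?_eq_some_iff.1 hp
      cases t with
      | nil =>
        have := hw.last_eq hs p (by simp [ht])
        omega
      | cons y t => simp [ht]
    · exact Piece.two_le hw (hB.isChain b hb) (hB.nodup b hb) hp hs
  refine ⟨?_, ?_, ?_, ?_, hcorner, ?_, ?_, ?_, hcol⟩
  · rw [← hB.body]
    intro P hP
    obtain ⟨b, hb, rfl⟩ := List.mem_map.1 hP
    exact (hB.wf b hb).ne_nil
  · rw [← hB.body]
    intro P hP
    obtain ⟨b, hb, rfl⟩ := List.mem_map.1 hP
    exact (hB.isChain b hb).infix (hinf b)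
  · rw [flatten_restrict]
    exact hG.nodup.filter _
  · rw [flatten_restrict]
    intro p hp
    simpa using (List.mem_filter.1 hp).2
  · rw [← hB.body, List.isChain_map]
    exact hB.link.imp_of_mem_imp fun x y hx hy hxy =>
      ⟨(hB.wf x hx).last_eq hxy.1, (hB.wf y hy).head_eq hxy.2⟩
  · rw [← hB.body, ← List.map_dropLast]
    intro P hP
    obtain ⟨b, hb, rfl⟩ := List.mem_map.1 hP
    exact htwo b (List.dropLast_subset _ hb) (hl.1 b hb)
  · intro e he hcond q hq hqc
    obtain ⟨B₀, b, rfl⟩ := List.eq_nil_or_concat' B |>.resolve_left hne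
    have hw := hB.wf b (by simp)
    have heb : e ∈ b.body.getLast? := by
      rw [← hB.body] at he
      simpa [List.getLast?_append_of_ne_nil _ hw.ne_nil] using he
    -- With a suffix the body would end in column `i + 1` and have two points, so `hcond` would
    -- fail.
    have hs : b.suf = [] := by
      by_contra hs
      have h1 := hw.last_eq hs e heb
      have h2 := htwo b (by simp) hs
      rcases hcond with hc | hc
      · omega
      · rw [← hB.body] at hc
        simp only [List.map_append, List.map_cons, List.map_nil, List.getLast?_concat,
          Option.some.injEq] at hc
        simp [hc] at h2
    have heG : e ∈ G.flatten.getLast? := by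
      rw [← hB.last b (by simp) hs]
      exact heb
    have h1 := hw.body_le e (List.mem_of_getLast? heb)
    rw [flatten_restrict, List.mem_filter]
    exact ⟨hG.trapped e heG (Or.inl (by omega)) q hq (by omega), by simpa using hqc⟩

theorem IsPartialWalk.isExtension {i : ℕ} {G : List (List (ℕ × Fin h))}
    (hG : IsPartialWalk (i + 2) G) {F : Frame h 2} {X : Frame h 3}
    (hF : F.1 = (restrict (i + 1) G).map (window i)) (hX : X.1 = G.map (window i)) :
    IsExtension F X := by
  have hR := hG.restrict_columns
  obtain ⟨B, hB, hne, hpre, -, S, L, X', hM, hI, hGX⟩ := hG.exists_decomposition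
  have hl := isChain_and_iff.1 hB.link
  have hlR := isChain_and_iff.1 hR.link
  refine ⟨?_, ?_, B.map fun b => (b.pre.map (shift i), b.suf.map (shift i)), ?_, S, L, X', ?_, ?_,
    hX.trans hGX⟩
  · rw [hF, ← List.map_tail]
    intro S hS
    obtain ⟨P, hP, rfl⟩ := List.mem_map.1 hS
    exact startsIn_window (hR.ne_nil P (List.mem_of_mem_tail hP)) (hlR.2 P hP)
  · rw [hF, ← List.map_dropLast]
    intro S hS
    obtain ⟨P, hP, rfl⟩ := List.mem_map.1 hS
    exact endsIn_window (hR.ne_nil P (List.dropLast_subset _ hP)) (hlR.1 P hP)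
  · refine ⟨by rw [hF, ← hB.body]; simp, ?_, ?_, ?_, ?_⟩
    · intro a ha p hp
      obtain ⟨b, hb, rfl⟩ := List.mem_map.1 ha
      rw [← List.map_append] at hp
      obtain ⟨x, hx, rfl⟩ := List.mem_map.1 hp
      have : x.1 = i + 1 + 1 := by
        rcases List.mem_append.1 hx with hx | hx
        · exact (hB.wf b hb).pre_eq x hx
        · exact (hB.wf b hb).suf_eq x hx
      simp only [shift]
      omega
    · intro a ha
      rw [List.head?_map, Option.mem_map] at ha
      obtain ⟨b, hb, rfl⟩ := ha
      simp [hpre b hb]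
    · rw [← List.map_tail]
      intro a ha
      obtain ⟨b, hb, rfl⟩ := List.mem_map.1 ha
      simpa using hl.2 b hb
    · rw [← List.map_dropLast]
      intro a ha
      obtain ⟨b, hb, rfl⟩ := List.mem_map.1 ha
      simpa using hl.1 b hb
  · rw [hF, ← hB.body, List.map_map, List.zipWith_map, List.zipWith_self]
    convert hM using 1
    refine List.map_congr_left fun b hb => ?_
    exact (Piece.window_path (hB.wf b hb) (by omega)).symm
  · convert hI using 1
    simp [List.getLast?_map]

theorem getLast_filter_of_mem {i : ℕ} {P : List (ℕ × Fin h)} {e : ℕ × Fin h}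
    (he : e ∈ P.getLast?) (hi : i ≤ e.1) :
    e ∈ (P.filter fun p => decide (i ≤ p.1)).getLast? := by
  obtain ⟨P, rfl⟩ := List.getLast?_eq_some_iff.1 he
  simp [hi]

/-- By `getLast_filter` the last visible point is the true end of the walk unless it lies in column
`i`, where validity tests nothing. -/
theorem IsPartialWalk.isValidExtension {i : ℕ} {G : List (List (ℕ × Fin h))}
    (hG : IsPartialWalk (i + 2) G) {F : Frame h 2} {X : Frame h 3}
    (hF : F.1 = (restrict (i + 1) G).map (window i)) (hX : X.1 = G.map (window i)) :
    IsValidExtension F X := by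
  refine ⟨hG.isExtension hF hX, ?_, ?_⟩
  · obtain ⟨p, hp, hpc⟩ := hG.exists_col
    refine ⟨shift i p, ?_, by simp [shift, hpc]⟩
    rw [hX]
    exact (mem_vertices_view.2 ⟨hp, by omega⟩).1
  · rw [hX]
    intro S hS e' he' hcond
    rw [List.getLast?_map, Option.mem_map] at hS
    obtain ⟨Q, hQ, rfl⟩ := hS
    obtain ⟨G₀, rfl⟩ := List.getLast?_eq_some_iff.1 hQ
    have hQne := hG.ne_nil Q (by simp)
    have hQch := hG.isChain Q (by simp)
    have heQ : Q.getLast hQne ∈ Q.getLast? := by simp [List.getLast?_eq_some_getLast hQne]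
    generalize hE : Q.getLast hQne = e at heQ
    have heG : e ∈ (G₀ ++ [Q]).flatten.getLast? := by
      simpa [List.getLast?_append_of_ne_nil _ hQne] using heQ
    rw [flatten_window, List.getLast?_map, Option.mem_map] at he'
    obtain ⟨e₀, he₀, rfl⟩ := he'
    obtain rfl : e₀ = e := by
      rcases getLast_filter hQch heQ he₀ with h1 | h1
      · exact h1
      · simp [shift, h1] at hcond
    have htrap : ∀ q, (grid h).Adj e₀ q → q.1 ≤ i + 2 → q ∈ (G₀ ++ [Q]).flatten := by
      refine hG.trapped e₀ heG ?_
      rcases hcond with hc | ⟨hc, hS⟩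
      · left
        simp only [shift] at hc
        omega
      · right
        rw [List.getLast?_concat]
        obtain ⟨Q, rfl⟩ := List.getLast?_eq_some_iff.1 heQ
        rcases List.eq_nil_or_concat' Q with rfl | ⟨Q, x, rfl⟩
        · rfl
        -- The predecessor `x` of an end in column `i + 2` lies in column `i + 1` or beyond, so it
        -- is visible too and the segment has two points.
        · exfalso
          have hadj := isChain_iff_pairs.1 hQch (x, e₀) (mem_pairs_append (by simp) (by simp))
          have := adj_col hadj
          simp only [shift] at hc this
          have hf := congrArg List.length (congrArg List.flatten hS)
          rw [flatten_window] at hf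
          simp only [List.append_assoc, List.filter_append, List.length_map,
            List.length_append] at hf
          rw [List.filter_cons_of_pos (by simp; omega),
            List.filter_cons_of_pos (by simp; omega)] at hf
          simp at hf
    intro q' hq' hqw
    have hei : i + 1 ≤ e₀.1 := by
      simp only [shift] at hcond
      omega
    have hq : shift i (q'.1 + i, q'.2) = q' := by simp [shift]
    rw [← hq, adj_shift (by omega) (by simp)] at hq'
    rw [← hq]
    exact (mem_vertices_view.2 ⟨htrap _ hq' (by simp only; omega), by simp⟩).1

end Restrict

/-! ## From a frame extension to a longer walk -/

section Extend

variable {h : ℕ}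

/-! ### Edges survive merging and insertion -/

theorem mem_pairs_joinSegments_left {S T : Segment h} {x : (ℕ × Fin h) × (ℕ × Fin h)}
    (hx : x ∈ S.flatMap pairs) : x ∈ (joinSegments S T).flatMap pairs := by
  induction S with
  | nil => simp at hx
  | cons P S ih =>
    cases S with
    | nil =>
      cases T with
      | nil => simpa [joinSegments] using hx
      | cons Q T =>
        rw [joinSegments, List.flatMap_cons, List.mem_append]
        left
        exact mem_pairs_append_left (by simpa using hx)
    | cons P' S =>
      rw [joinSegments]
      rw [List.flatMap_cons, List.mem_append] at hx ⊢
      exact hx.imp id ih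

theorem mem_pairs_joinSegments_right {S T : Segment h} {x : (ℕ × Fin h) × (ℕ × Fin h)}
    (hx : x ∈ T.flatMap pairs) : x ∈ (joinSegments S T).flatMap pairs := by
  induction S with
  | nil => simpa [joinSegments] using hx
  | cons P S ih =>
    cases S with
    | nil =>
      cases T with
      | nil => simp at hx
      | cons Q T =>
        rw [joinSegments]
        rw [List.flatMap_cons, List.mem_append] at hx ⊢
        exact hx.imp mem_pairs_append_right id
    | cons P' S =>
      rw [joinSegments]
      rw [List.flatMap_cons, List.mem_append]
      exact Or.inr ih

/-- Merging only adds edges. Together with the same fact for insertions this transfers adjacency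
from the final frame back to the lengthened segments. -/
theorem Merges.mem_pairs {L M : List (Segment h)} (hM : Merges L M)
    {x : (ℕ × Fin h) × (ℕ × Fin h)} (hx : x ∈ L.flatten.flatMap pairs) :
    x ∈ M.flatten.flatMap pairs := by
  induction hM with
  | nil => exact hx
  | keep _ ih =>
    rw [List.flatten_cons, List.flatMap_append, List.mem_append] at hx ⊢
    exact hx.imp id ih
  | join _ ih =>
    refine ih ?_
    simp only [List.flatten_cons, List.flatMap_append, List.mem_append] at hx ⊢
    rcases hx with hx | hx | hx
    · exact Or.inl (mem_pairs_joinSegments_left hx)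
    · exact Or.inl (mem_pairs_joinSegments_right hx)
    · exact Or.inr hx

theorem Inserts.mem_pairs {q : Prop} {L X : List (Segment h)} (hI : Inserts q L X)
    {x : (ℕ × Fin h) × (ℕ × Fin h)} (hx : x ∈ L.flatten.flatMap pairs) :
    x ∈ X.flatten.flatMap pairs := by
  induction hI with
  | nil => exact hx
  | old _ ih =>
    rw [List.flatten_cons, List.flatMap_append, List.mem_append] at hx ⊢
    exact hx.imp id ih
  | new _ _ _ _ ih =>
    rw [List.flatten_cons, List.flatMap_append, List.mem_append]
    exact Or.inr (ih hx)

theorem mem_pairs_extendEnd {S : Segment h} (hS : ∀ P ∈ S, P ≠ []) {suf : List (ℕ × Fin h)}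
    {a b : ℕ × Fin h} (ha : a ∈ S.flatten.getLast?) (hb : b ∈ suf.head?) :
    (a, b) ∈ (extendEnd suf S).flatMap pairs := by
  induction S with
  | nil => simp at ha
  | cons P S ih =>
    cases S with
    | nil =>
      simp only [extendEnd, List.flatMap_cons, List.flatMap_nil, List.append_nil]
      exact mem_pairs_append (by simpa using ha) hb
    | cons P' S =>
      rw [extendEnd, List.flatMap_cons, List.mem_append]
      rw [List.forall_mem_cons] at hS
      refine Or.inr (ih hS.2 ?_)
      rwa [List.flatten_cons, List.getLast?_append_of_ne_nil] at ha
      simp [hS.2 P' (by simp)]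

/-- Undoes the shift: the added points of column `2` are placed in column `i + 2` around the full
paths of `G` rather than their windows. -/
theorem exists_pieces_of_lengthening (i : ℕ)
    {A : List (List (ℕ × Fin h) × List (ℕ × Fin h))} {G : List (List (ℕ × Fin h))}
    (hlen : A.length = G.length) (hcol : ∀ a ∈ A, ∀ p ∈ a.1 ++ a.2, p.1 = 2) :
    ∃ B : List (Piece h), B.map Piece.body = G ∧
      B.map (fun b => (b.pre.map (shift i), b.suf.map (shift i))) = A ∧
      ∀ b ∈ B, (∀ x ∈ b.pre, x.1 = i + 2) ∧ ∀ x ∈ b.suf, x.1 = i + 2 := by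
  induction A generalizing G with
  | nil =>
    obtain rfl : G = [] := by simpa [eq_comm] using hlen
    exact ⟨[], by simp⟩
  | cons a A ih =>
    obtain _ | ⟨P, G⟩ := G
    · simp at hlen
    rw [List.forall_mem_cons] at hcol
    obtain ⟨B, h1, h2, h3⟩ := ih (G := G) (by simpa using hlen) hcol.2
    have hlift : ∀ l : List (ℕ × Fin h), (∀ p ∈ l, p.1 = 2) →
        (l.map fun p => (i + p.1, p.2)).map (shift i) = l ∧
          ∀ x ∈ l.map fun p => (i + p.1, p.2), x.1 = i + 2 := by
      intro l hl
      refine ⟨by simp [shift, Function.comp_def], ?_⟩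
      intro x hx
      obtain ⟨p, hp, rfl⟩ := List.mem_map.1 hx
      simp [hl p hp]
    have ha1 := hlift a.1 fun p hp => hcol.1 p (List.mem_append_left _ hp)
    have ha2 := hlift a.2 fun p hp => hcol.1 p (List.mem_append_right _ hp)
    refine ⟨⟨a.1.map fun p => (i + p.1, p.2), P, a.2.map fun p => (i + p.1, p.2)⟩ :: B, ?_, ?_, ?_⟩
    · rw [List.map_cons, h1]
    · rw [List.map_cons, h2, ha1.1, ha2.1]
    · exact List.forall_mem_cons.2 ⟨⟨ha1.2, ha2.2⟩, h3⟩

/-! ### Lifting merges and insertions from windows to full paths -/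

/-- A path does not step from the columns `< i` to the columns `> i + 1`, or back. -/
def NoJump (i : ℕ) (P : List (ℕ × Fin h)) : Prop :=
  P.IsChain fun a b => (a.1 ≤ i + 1 ∧ b.1 ≤ i + 1) ∨ (i ≤ a.1 ∧ i ≤ b.1)

theorem noJump_of_le {i : ℕ} {P : List (ℕ × Fin h)} (hP : ∀ x ∈ P, x.1 ≤ i + 1) : NoJump i P :=
  isChain_iff_pairs.2 fun _ hx =>
    Or.inl ⟨hP _ (mem_of_mem_pairs hx).1, hP _ (mem_of_mem_pairs hx).2⟩

theorem noJump_of_ge {i : ℕ} {P : List (ℕ × Fin h)} (hP : ∀ x ∈ P, i ≤ x.1) : NoJump i P :=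
  isChain_iff_pairs.2 fun _ hx =>
    Or.inr ⟨hP _ (mem_of_mem_pairs hx).1, hP _ (mem_of_mem_pairs hx).2⟩

theorem NoJump.append {i : ℕ} {P Q : List (ℕ × Fin h)} (hP : NoJump i P) (hQ : NoJump i Q)
    (hPQ : ∀ a ∈ P.getLast?, ∀ b ∈ Q.head?, i ≤ a.1 ∧ i ≤ b.1) : NoJump i (P ++ Q) :=
  List.isChain_append.2 ⟨hP, hQ, fun a ha b hb => Or.inr (hPQ a ha b hb)⟩

theorem Piece.noJump {i : ℕ} {b : Piece h} (hb : b.Wf (i + 1)) : NoJump i b.path := by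
  have hpre : ∀ x ∈ b.pre, i ≤ x.1 := fun x hx => by rw [hb.pre_eq x hx]; omega
  have hsuf : ∀ x ∈ b.suf, i ≤ x.1 := fun x hx => by rw [hb.suf_eq x hx]; omega
  refine (noJump_of_ge hpre).append ((noJump_of_le hb.body_le).append (noJump_of_ge hsuf) ?_) ?_
  · intro x hx y hy
    have hy := List.mem_of_mem_head? hy
    refine ⟨?_, hsuf y hy⟩
    rw [hb.last_eq (List.ne_nil_of_mem hy) x hx]
    omega
  · intro x hx y hy
    have hx := List.mem_of_getLast? hx
    refine ⟨hpre x hx, ?_⟩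
    rw [List.head?_append_of_ne_nil _ hb.ne_nil] at hy
    rw [hb.head_eq (List.ne_nil_of_mem hx) y hy]
    omega

theorem Piece.runs_path {c : ℕ} {b : Piece h} (hb : b.Wf c) :
    runs (fun p => decide (p.1 ≤ c)) b.path = [b.body] := by
  have hpre : ∀ x ∈ b.pre, decide (x.1 ≤ c) = false := fun x hx => by simp [hb.pre_eq x hx]
  have hsuf : ∀ x ∈ b.suf, decide (x.1 ≤ c) = false := fun x hx => by simp [hb.suf_eq x hx]
  rw [Piece.path, runs_append (Or.inl fun a ha => hpre a (List.mem_of_getLast? ha)),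
    runs_append (Or.inr fun a ha => hsuf a (List.mem_of_mem_head? ha)), runs_eq_nil hpre,
    runs_eq_nil hsuf, runs_eq_singleton hb.ne_nil (by simpa using hb.body_le)]
  rfl

/-- The paths are nonempty, meet the columns `≤ i + 1` and do not jump. -/
structure IsOldPath (i : ℕ) (P : List (ℕ × Fin h)) : Prop where
  ne_nil : P ≠ []
  noJump : NoJump i P
  exists_le : ∃ x ∈ P, x.1 ≤ i + 1

/-- The first path ends and the second path starts in column `c`. -/
def Linked (c : ℕ) (P Q : List (ℕ × Fin h)) : Prop :=
  (∀ e ∈ P.getLast?, e.1 = c) ∧ ∀ s ∈ Q.head?, s.1 = c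

/-- Both points at a merge lie in column `i + 2`. Concatenating the full paths there joins their
windows, creates no jump and leaves the restriction to the columns `≤ i + 1` unchanged. -/
theorem Merges.lift {i : ℕ} {L : List (List (ℕ × Fin h))} {M : List (Segment h)}
    (hM : Merges (L.map (window i)) M) (hL : ∀ P ∈ L, IsOldPath i P)
    (hlink : L.IsChain (Linked (i + 2))) :
    ∃ N : List (List (ℕ × Fin h)), M = N.map (window i) ∧ (∀ P ∈ N, IsOldPath i P) ∧
      N.IsChain (Linked (i + 2)) ∧ N.flatten = L.flatten ∧
      restrict (i + 1) N = restrict (i + 1) L := by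
  generalize hK : L.map (window i) = K at hM
  induction hM generalizing L with
  | nil =>
    obtain rfl : L = [] := by simpa using hK
    exact ⟨[], by simp⟩
  | @keep S K M _ ih =>
    obtain ⟨P, L, rfl, rfl, rfl⟩ := List.map_eq_cons_iff.1 hK
    rw [List.forall_mem_cons] at hL
    obtain ⟨N, rfl, hN, hNlink, hNflat, hNres⟩ := ih hL.2 hlink.tail rfl
    refine ⟨P :: N, by simp, List.forall_mem_cons.2 ⟨hL.1, hN⟩,
      List.isChain_cons.2 ⟨fun Q hQ => ?_, hNlink⟩, by simp [hNflat], ?_⟩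
    · obtain ⟨N, rfl⟩ := List.head?_eq_some_iff.1 hQ
      have hQne := (hN Q (by simp)).ne_nil
      obtain _ | ⟨R, L⟩ := L
      · simp [hQne] at hNflat
      · rw [List.isChain_cons_cons] at hlink
        refine ⟨hlink.1.1, fun s hs => hlink.1.2 s ?_⟩
        have := congrArg List.head? hNflat
        rw [List.flatten_cons, List.flatten_cons, List.head?_append_of_ne_nil _ hQne,
          List.head?_append_of_ne_nil _ (hL.2 R (by simp)).ne_nil] at this
        rwa [← this]
    · simp only [restrict, List.flatMap_cons] at hNres ⊢
      rw [hNres]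
  | @join S T K M _ ih =>
    obtain ⟨P, L', rfl, rfl, hK'⟩ := List.map_eq_cons_iff.1 hK
    obtain ⟨Q, L, rfl, rfl, rfl⟩ := List.map_eq_cons_iff.1 hK'
    simp only [List.forall_mem_cons] at hL
    obtain ⟨hP, hQ, hL⟩ := hL
    have hPQ := (List.isChain_cons_cons.1 hlink).1
    have key := ih (L := (P ++ Q) :: L) ?_ ?_ ?_
    · obtain ⟨N, rfl, hN, hNlink, hNflat, hNres⟩ := key
      refine ⟨N, rfl, hN, hNlink, by simp [hNflat], ?_⟩
      rw [hNres]
      simp only [restrict, List.flatMap_cons]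
      rw [runs_append, List.append_assoc]
      left
      intro a ha
      simp [hPQ.1 a ha]
    · refine List.forall_mem_cons.2 ⟨⟨by simp [hP.ne_nil], hP.noJump.append hQ.noJump ?_, ?_⟩, hL⟩
      · intro a ha b hb
        rw [hPQ.1 a ha, hPQ.2 b hb]
        omega
      · obtain ⟨x, hx, hxc⟩ := hP.exists_le
        exact ⟨x, List.mem_append_left _ hx, hxc⟩
    · have hl := hlink.tail
      cases L with
      | nil => simp
      | cons R L =>
        rw [List.tail_cons, List.isChain_cons_cons] at hl
        rw [List.isChain_cons_cons]
        refine ⟨⟨?_, hl.1.2⟩, hl.2⟩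
        rw [List.getLast?_append_of_ne_nil _ hQ.ne_nil]
        exact hl.1.1
    · rw [List.map_cons, window_append hP.ne_nil hQ.ne_nil]
      · intro a ha
        rw [hPQ.1 a ha]
        omega
      · intro a ha
        rw [hPQ.2 a ha]
        omega

/-- The path `Q` preceding the list is carried along, since an inserted path needs an end in column
`i + 2` before it. -/
theorem Inserts.lift {i : ℕ} {q : Prop} {L X : List (Segment h)} (hI : Inserts q L X)
    (hX : ∀ S ∈ X, ∀ P ∈ S, P ≠ []) {N : List (List (ℕ × Fin h))} {Q : List (ℕ × Fin h)}
    (hL : N.map (window i) = L) (hN : ∀ P ∈ N, IsOldPath i P) (hQ : Q ≠ [])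
    (hlink : (Q :: N).IsChain (Linked (i + 2)))
    (hq : q → ∀ e ∈ (Q :: N).flatten.getLast?, e.1 = i + 2) :
    ∃ Y : List (List (ℕ × Fin h)), X = Y.map (window i) ∧ (∀ P ∈ Y, P ≠ [] ∧ NoJump i P) ∧
      (Q :: Y).IsChain (Linked (i + 2)) ∧ (∀ P ∈ Y.dropLast, 2 ≤ P.length) ∧
      restrict (i + 1) Y = restrict (i + 1) N := by
  induction hI generalizing N Q with
  | nil =>
    obtain rfl : N = [] := by simpa using hL
    exact ⟨[], by simp⟩
  | @old S L X _ ih =>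
    obtain ⟨P, N, rfl, rfl, rfl⟩ := List.map_eq_cons_iff.1 hL
    rw [List.forall_mem_cons] at hN hX
    rw [List.isChain_cons_cons] at hlink
    obtain ⟨Y, rfl, hY, hYlink, hYtwo, hYres⟩ := ih hX.2 rfl hN.2 hN.1.ne_nil hlink.2 (by
      intro hq' e he
      refine hq hq' e ?_
      rw [List.flatten_cons, List.getLast?_append_of_ne_nil]
      · exact he
      · simp [hN.1.ne_nil])
    refine ⟨P :: Y, by simp, List.forall_mem_cons.2 ⟨⟨hN.1.ne_nil, hN.1.noJump⟩, hY⟩,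
      List.isChain_cons_cons.2 ⟨hlink.1, hYlink⟩, ?_, ?_⟩
    · cases Y with
      | nil => simp
      | cons R Y =>
        rw [List.dropLast_cons_cons, List.forall_mem_cons]
        refine ⟨?_, hYtwo⟩
        -- The path starts in column `i + 2` and visits the columns `≤ i + 1`, so it has two points.
        obtain ⟨x, hx, hxc⟩ := hN.1.exists_le
        obtain _ | ⟨a, _ | ⟨b, P⟩⟩ := P
        · simp at hx
        · obtain rfl : x = a := by simpa using hx
          have := hlink.1.2 x (by simp)
          omega
        · simp
    · simp only [restrict, List.flatMap_cons] at hYres ⊢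
      rw [hYres]
  | @new P L X hcol htwo hqL _ ih =>
    rw [List.forall_mem_cons] at hX
    have hP : P ≠ [] := hX.1 P (by simp)
    obtain ⟨P', hP'⟩ : ∃ P', P' = P.map fun p => (i + p.1, p.2) := ⟨_, rfl⟩
    have hcol' : ∀ x ∈ P', x.1 = i + 2 := by
      intro x hx
      rw [hP'] at hx
      obtain ⟨p, hp, rfl⟩ := List.mem_map.1 hx
      simp [hcol p hp]
    have hne : P' ≠ [] := by simpa [hP'] using hP
    have hwin : window i P' = [P] := by
      rw [window_eq_singleton hne fun p hp => by rw [hcol' p hp]; omega, hP']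
      simp [shift, Function.comp_def]
    -- If an old path still follows, `Q` is already linked to it; otherwise the new path comes
    -- behind all old ones and `q` applies.
    have hQlast : ∀ e ∈ Q.getLast?, e.1 = i + 2 := by
      cases N with
      | nil => simpa using hq (hqL (by simpa using hL.symm))
      | cons R N => exact (List.isChain_cons_cons.1 hlink).1.1
    have hP'last : ∀ e ∈ P'.getLast?, e.1 = i + 2 := fun e he => hcol' e (List.mem_of_getLast? he)
    obtain ⟨Y, rfl, hY, hYlink, hYtwo, hYres⟩ := ih hX.2 hL hN hne
      (by
        cases N with
        | nil => simp
        | cons R N =>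
          rw [List.isChain_cons_cons] at hlink ⊢
          exact ⟨⟨hP'last, hlink.1.2⟩, hlink.2⟩)
      (by
        intro hq' e he
        cases N with
        | nil => exact hP'last e (by simpa using he)
        | cons R N =>
          refine hq hq' e ?_
          have hR : (R :: N).flatten ≠ [] := by simp [(hN R (by simp)).ne_nil]
          rw [List.flatten_cons, List.getLast?_append_of_ne_nil _ hR] at he ⊢
          exact he)
    refine ⟨P' :: Y, by simp [hwin], List.forall_mem_cons.2 ⟨⟨hne, noJump_of_ge ?_⟩, hY⟩,
      List.isChain_cons_cons.2 ⟨⟨hQlast, fun s hs => hcol' s (List.mem_of_mem_head? hs)⟩, hYlink⟩,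
      ?_, ?_⟩
    · intro x hx
      rw [hcol' x hx]
      omega
    · cases Y with
      | nil => simp
      | cons R Y =>
        rw [List.dropLast_cons_cons, List.forall_mem_cons]
        exact ⟨by simpa [hP'] using htwo (by simp), hYtwo⟩
    · rw [← hYres, restrict, List.flatMap_cons, runs_eq_nil]
      · rfl
      · intro x hx
        simp [hcol' x hx]

/-- All copies of an entry pass the same filter. The two filters used are the columns `≤ i + 1` and
`≥ i`. -/
theorem nodup_of_filter {α : Type*} {p q : α → Bool} {l : List α}
    (hp : (l.filter p).Nodup) (hq : (l.filter q).Nodup) (hpq : ∀ a ∈ l, p a = true ∨ q a = true) :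
    l.Nodup := by
  classical
  rw [List.nodup_iff_count_le_one]
  intro a
  by_cases ha : a ∈ l
  · rcases hpq a ha with h | h
    · rw [← List.count_filter h]
      exact List.nodup_iff_count_le_one.1 hp a
    · rw [← List.count_filter h]
      exact List.nodup_iff_count_le_one.1 hq a
  · rw [List.count_eq_zero_of_not_mem ha]
    omega

/-- The structure of an extension of the frame of a partial walk, in terms of paths. -/
theorem IsPartialWalk.exists_lift {i : ℕ} {G : List (List (ℕ × Fin h))}
    (hG : IsPartialWalk (i + 1) G) {F : Frame h 2} {X : Frame h 3}
    (hF : F.1 = G.map (window i)) (hX : IsExtension F X) :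
    ∃ Y : List (List (ℕ × Fin h)), X.1 = Y.map (window i) ∧ restrict (i + 1) Y = G ∧
      (∀ P ∈ Y, P ≠ [] ∧ NoJump i P) ∧ Y.IsChain (Linked (i + 2)) ∧
      (∀ P ∈ Y.dropLast, 2 ≤ P.length) ∧ Y.flatten.head? = G.flatten.head? := by
  obtain ⟨-, -, A, hA, S, L, X', hM, hI, hXS⟩ := hX
  obtain ⟨B, hBG, rfl, hBcol⟩ := exists_pieces_of_lengthening i
    (A := A) (G := G) (by rw [hA.length_eq, hF, List.length_map]) hA.column
  have hlG := isChain_and_iff.1 hG.link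
  have hmem : ∀ b ∈ B, b.body ∈ G := fun b hb => hBG ▸ List.mem_map_of_mem hb
  have hhead : ∀ b ∈ B.head?, b.pre = [] := by
    intro b hb
    have := hA.first_start (b.pre.map (shift i), b.suf.map (shift i))
      (by rw [List.head?_map, Option.mem_map]; exact ⟨b, hb, rfl⟩)
    simpa using this
  have hstarts : ∀ b ∈ B.tail, b.pre ≠ [] := by
    intro b hb
    have := hA.starts (b.pre.map (shift i), b.suf.map (shift i))
      (by rw [← List.map_tail]; exact List.mem_map.2 ⟨b, hb, rfl⟩)
    simpa using this
  have hends : ∀ b ∈ B.dropLast, b.suf ≠ [] := by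
    intro b hb
    have := hA.ends (b.pre.map (shift i), b.suf.map (shift i))
      (by rw [← List.map_dropLast]; exact List.mem_map.2 ⟨b, hb, rfl⟩)
    simpa using this
  rw [hF, ← hBG, List.map_map, List.zipWith_map, List.zipWith_self] at hM
  have hadj : ∀ x ∈ (S :: L).flatten.flatMap pairs, (grid h).Adj x.1 x.2 := by
    intro x hx
    have hx' : x ∈ X.1.flatten.flatMap pairs := by
      rw [hXS]
      rw [List.flatten_cons, List.flatMap_append, List.mem_append] at hx ⊢
      exact hx.imp id hI.mem_pairs
    obtain ⟨P, hP, hx'⟩ := List.mem_flatMap.1 hx'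
    obtain ⟨T, hT, hP⟩ := List.mem_flatten.1 hP
    exact isChain_iff_pairs.1 (X.2.isChain T hT P hP) x hx'
  have hwf : ∀ b ∈ B, b.Wf (i + 1) := by
    intro b hb
    have hne := hG.ne_nil _ (hmem b hb)
    have hle : ∀ x ∈ b.body, x.1 ≤ i + 1 := fun x hx =>
      hG.le x (List.mem_flatten.2 ⟨_, hmem b hb, hx⟩)
    refine ⟨hne, hle, (hBcol b hb).1, (hBcol b hb).2, ?_, ?_⟩
    · intro hpre
      obtain ⟨b₀, B, rfl⟩ := List.exists_cons_of_ne_nil (List.ne_nil_of_mem hb)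
      rcases List.mem_cons.1 hb with rfl | hb
      · exact absurd (hhead b (by simp)) hpre
      · exact hlG.2 b.body
          (by rw [← hBG, List.map_cons, List.tail_cons]; exact List.mem_map_of_mem hb)
    -- For the last piece the definition of a lengthening does not state that the end is in column
    -- `i + 1`. It follows from the extended frame: the last visible point is adjacent to column `i
    -- + 2`, so it is not in column `i` and is the true end.
    · intro hsuf e he
      obtain ⟨x, hx, hxc⟩ := hG.exists_mem_col (hmem b hb)
      have hfne : (b.body.filter fun p => decide (i ≤ p.1)) ≠ [] :=
        List.ne_nil_of_mem (List.mem_filter.2 ⟨hx, by simp; omega⟩)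
      obtain ⟨e', he'⟩ : ∃ e', e' ∈ (b.body.filter fun p => decide (i ≤ p.1)).getLast? :=
        ⟨_, List.getLast?_eq_some_getLast hfne⟩
      have he'm := List.mem_filter.1 (List.mem_of_getLast? he')
      have hwl : shift i e' ∈ (window i b.body).flatten.getLast? := by
        rw [flatten_window, List.getLast?_map, Option.mem_map]
        exact ⟨e', he', rfl⟩
      have hpaths : ∀ P ∈ window i b.body, P ≠ [] := by
        intro P hP
        obtain ⟨R, hR, rfl⟩ := List.mem_map.1 hP
        simpa using ne_nil_of_mem_runs hR
      have hpair := mem_pairs_extendEnd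
        (S := extendStart (b.pre.map (shift i)) (window i b.body)) (suf := b.suf.map (shift i))
        (a := shift i e') (b := shift i (b.suf.head hsuf)) ?_ ?_ ?_
      · have := hadj _ (hM.mem_pairs (x := (shift i e', shift i (b.suf.head hsuf)))
          (List.mem_flatMap.2 ?_))
        · have h1 := (hBcol b hb).2 _ (List.head_mem hsuf)
          have h2 := adj_col this
          have h3 := hle e' he'm.1
          simp only [shift, h1] at h2
          rcases getLast_filter (hG.isChain _ (hmem b hb)) he he' with rfl | h4
          · omega
          · omega
        · obtain ⟨P, hP, hx⟩ := List.mem_flatMap.1 hpair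
          exact ⟨P, List.mem_flatten.2 ⟨_, List.mem_map.2 ⟨b, hb, rfl⟩, hP⟩, hx⟩
      · obtain ⟨R, W, hW⟩ := List.exists_cons_of_ne_nil (window_ne_nil (i := i) hx (by omega))
        rw [hW] at hpaths ⊢
        rw [List.forall_mem_cons] at hpaths
        rw [extendStart, List.forall_mem_cons]
        exact ⟨by simp [hpaths.1], hpaths.2⟩
      · obtain ⟨R, W, hW⟩ := List.exists_cons_of_ne_nil (window_ne_nil (i := i) hx (by omega))
        rw [hW] at hpaths hwl ⊢
        have : (R :: W).flatten ≠ [] := by simp [hpaths R (by simp)]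
        rw [extendStart, List.flatten_cons, List.append_assoc, ← List.flatten_cons,
          List.getLast?_append_of_ne_nil _ this]
        exact hwl
      · simp [List.head?_eq_some_head hsuf]
  have hBne : B ≠ [] := by
    rintro rfl
    exact hG.ne_empty hBG.symm
  have hM' : Merges ((B.map Piece.path).map (window i)) (S :: L) := by
    convert hM using 1
    rw [List.map_map]
    exact List.map_congr_left fun b hb => Piece.window_path (hwf b hb) (by omega)
  obtain ⟨N, hN, hNold, hNlink, hNflat, hNres⟩ := hM'.lift
    (by
      intro P hP
      obtain ⟨b, hb, rfl⟩ := List.mem_map.1 hP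
      have hw := hwf b hb
      refine ⟨Piece.path_ne_nil hw, Piece.noJump hw, b.body.head hw.ne_nil, ?_,
        hw.body_le _ (List.head_mem _)⟩
      simp [Piece.path])
    (by
      rw [List.isChain_map]
      have hl : B.IsChain fun b b' => b.suf ≠ [] ∧ b'.pre ≠ [] :=
        isChain_and_iff.2 ⟨hends, hstarts⟩
      exact hl.imp_of_mem_imp fun x y hx hy hxy =>
        ⟨Piece.getLast_path (hwf x hx) hxy.1, Piece.head_path (hwf y hy) hxy.2⟩)
  obtain ⟨Q, N, rfl, rfl, rfl⟩ := List.map_eq_cons_iff.1 hN.symm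
  rw [List.forall_mem_cons] at hNold
  have hXne : ∀ S ∈ X', ∀ P ∈ S, P ≠ [] := fun S hS =>
    X.2.path_ne_nil S (by rw [hXS]; exact List.mem_cons_of_mem _ hS)
  obtain ⟨Y, rfl, hY, hYlink, hYtwo, hYres⟩ := hI.lift hXne rfl hNold.2 hNold.1.ne_nil hNlink
    (by
      rintro ⟨a, ha, hane⟩ e he
      rw [List.getLast?_map, Option.mem_map] at ha
      obtain ⟨b, hb, rfl⟩ := ha
      obtain ⟨B, rfl⟩ := List.getLast?_eq_some_iff.1 hb
      have hw := hwf b (by simp)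
      rw [hNflat] at he
      simp only [List.map_append, List.map_cons, List.map_nil, List.flatten_append,
        List.flatten_singleton, List.getLast?_append_of_ne_nil _ (Piece.path_ne_nil hw)] at he
      exact Piece.getLast_path hw (by simpa using hane) e he)
  have hhd : (Q :: Y).flatten.head? = G.flatten.head? := by
    rw [List.flatten_cons, List.head?_append_of_ne_nil _ hNold.1.ne_nil]
    have h1 := congrArg List.head? hNflat
    rw [List.flatten_cons, List.head?_append_of_ne_nil _ hNold.1.ne_nil] at h1
    rw [h1, ← hBG]
    obtain ⟨b, B, rfl⟩ := List.exists_cons_of_ne_nil hBne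
    have hw := hwf b (by simp)
    simp [Piece.path, hhead b (by simp), List.head?_append_of_ne_nil _ hw.ne_nil]
  refine ⟨Q :: Y, by simp [hXS], ?_, List.forall_mem_cons.2 ⟨⟨hNold.1.ne_nil, hNold.1.noJump⟩, hY⟩,
    hYlink, ?_, hhd⟩
  · have : restrict (i + 1) (Q :: Y) = restrict (i + 1) (Q :: N) := by
      simp only [restrict, List.flatMap_cons] at hYres ⊢
      rw [hYres]
    rw [this, hNres, ← hBG, restrict, List.flatMap_map]
    have : ∀ C : List (Piece h), (∀ b ∈ C, b.Wf (i + 1)) →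
        C.flatMap (fun b => runs (fun p => decide (p.1 ≤ i + 1)) b.path) = C.map Piece.body := by
      intro C hC
      induction C with
      | nil => rfl
      | cons b C ih =>
        rw [List.forall_mem_cons] at hC
        rw [List.flatMap_cons, Piece.runs_path hC.1, ih hC.2]
        rfl
    exact this B hwf
  · cases Y with
    | nil => simp
    | cons R Y =>
      rw [List.dropLast_cons_cons, List.forall_mem_cons]
      refine ⟨?_, hYtwo⟩
      obtain ⟨p, hp, hp0, -⟩ := hG.corner
      rw [← hhd, List.flatten_cons, List.head?_append_of_ne_nil _ hNold.1.ne_nil] at hp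
      obtain ⟨Q, rfl⟩ := List.head?_eq_some_iff.1 hp
      cases Q with
      | nil =>
        have := (List.isChain_cons_cons.1 hYlink).1.1 p (by simp)
        omega
      | cons y Q => simp

/-- Since the lifted paths do not jump, each of their edges is an edge of `G` or is visible in `X`;
likewise a repeated point would be repeated in one of the two. -/
theorem IsPartialWalk.exists_extension {i : ℕ} {G : List (List (ℕ × Fin h))}
    (hG : IsPartialWalk (i + 1) G) {F : Frame h 2} {X : Frame h 3}
    (hF : F.1 = G.map (window i)) (hX : IsValidExtension F X) :
    ∃ Y : List (List (ℕ × Fin h)), IsPartialWalk (i + 2) Y ∧ restrict (i + 1) Y = G ∧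
      X.1 = Y.map (window i) := by
  obtain ⟨hext, hcol, htrap⟩ := hX
  obtain ⟨Y, hXY, hres, hY, hlink, htwo, hhead⟩ := hG.exists_lift hF hext
  have hflat : G.flatten = Y.flatten.filter fun p => decide (p.1 ≤ i + 1) := by
    rw [← hres, flatten_restrict]
  have hmemX : ∀ q, shift i q ∈ vertices X.1 → i ≤ q.1 → q ∈ Y.flatten := by
    intro q hq hi
    rw [hXY] at hq
    exact (mem_vertices_view.1 ⟨hq, hi⟩).1
  refine ⟨Y, ⟨fun P hP => (hY P hP).1, ?_, ?_, ?_, ?_, hlink, htwo, ?_, ?_⟩, hres, hXY⟩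
  · intro P hP
    rw [isChain_iff_pairs]
    intro x hx
    have hxY : x ∈ Y.flatMap pairs := List.mem_flatMap.2 ⟨P, hP, hx⟩
    rcases isChain_iff_pairs.1 (hY P hP).2 x hx with hc | hc
    · refine hG.pairs_adj x ?_
      rw [← hres, pairs_restrict, List.mem_filter]
      exact ⟨hxY, by simpa using hc⟩
    · rw [← adj_shift hc.1 hc.2]
      have hxX : Prod.map (shift i) (shift i) x ∈ X.1.flatten.flatMap pairs := by
        rw [hXY, pairs_view]
        exact List.mem_map.2 ⟨x, List.mem_filter.2 ⟨hxY, by simpa using hc⟩, rfl⟩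
      obtain ⟨R, hR, hxR⟩ := List.mem_flatMap.1 hxX
      obtain ⟨S, hS, hRS⟩ := List.mem_flatten.1 hR
      exact isChain_iff_pairs.1 (X.2.isChain S hS R hRS) _ hxR
  · refine nodup_of_filter (hflat ▸ hG.nodup) (q := fun p => decide (i ≤ p.1)) ?_ ?_
    · have := X.2.nodup
      rw [hXY, vertices_view] at this
      exact this.of_map
    · intro a _
      simp only [decide_eq_true_eq]
      omega
  · intro p hp
    by_cases hi : i ≤ p.1
    · have := X.2.window (shift i p) (by rw [hXY]; exact (mem_vertices_view.2 ⟨hp, hi⟩).1)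
      simp only [shift] at this
      omega
    · omega
  · rw [hhead]
    exact hG.corner
  · intro e he hcond q hq hqc
    have hYne : Y ≠ [] := by
      rintro rfl
      simp at he
    obtain ⟨Y₀, Q, rfl⟩ := List.eq_nil_or_concat' Y |>.resolve_left hYne
    have hQne := (hY Q (by simp)).1
    have heQ : e ∈ Q.getLast? := by
      simpa [List.getLast?_append_of_ne_nil _ hQne] using he
    have hac := adj_col hq
    -- An end left of column `i + 1` is already the trapped end of `G`, and its neighbours are in
    -- the columns `≤ i + 1`. Further right the validity test of `X` applies.
    by_cases hlt : e.1 < i + 1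
    · have heG : e ∈ G.flatten.getLast? := by
        rw [hflat]
        obtain ⟨t, ht⟩ := List.getLast?_eq_some_iff.1 he
        rw [ht, List.filter_append, List.filter_cons_of_pos (by simp; omega)]
        simp
      have := hG.trapped e heG (Or.inl hlt) q hq (by omega)
      rw [hflat] at this
      exact (List.mem_filter.1 this).1
    · have hS : window i Q ∈ X.1.getLast? := by
        rw [hXY]
        simp
      have heS : shift i e ∈ (window i Q).flatten.getLast? := by
        rw [flatten_window, List.getLast?_map, Option.mem_map]
        exact ⟨e, getLast_filter_of_mem heQ (by omega), rfl⟩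
      refine hmemX q (htrap _ hS _ heS ?_ (shift i q) ?_ ?_) (by omega)
      · by_cases hlt' : e.1 < i + 2
        · left
          simp only [shift]
          omega
        · right
          rcases hcond with hc | hc
          · exact absurd hc hlt'
          · have hQe : Q = [e] := by simpa using hc
            have hec : e.1 ≤ i + 2 := by
              have := X.2.window (shift i e)
                (by rw [hXY]; exact (mem_vertices_view.2 ⟨List.mem_of_getLast? he, by omega⟩).1)
              simp only [shift] at this
              omega
            refine ⟨by simp only [shift]; omega, ?_⟩
            rw [hQe, window_eq_singleton (by simp) (by simp; omega)]
            simp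
      · exact (adj_shift (by omega) (by omega)).2 hq
      · simp only [shift]
        omega
  · obtain ⟨p, hp, hpc⟩ := hcol
    rw [hXY, vertices_view] at hp
    obtain ⟨q, hq, rfl⟩ := List.mem_map.1 hp
    refine ⟨q, (List.mem_filter.1 hq).1, ?_⟩
    simp only [shift] at hpc
    omega

end Extend

/-! ## Walks in the directed graph of frames and partial walks -/

section Traces

variable {h : ℕ}

theorem window_zero {P : List (ℕ × Fin h)} (hP : P ≠ []) : window 0 P = [P] := by
  rw [window_eq_singleton hP (by simp)]
  have : shift (h := h) 0 = id := rfl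
  simp [this]

theorem map_window_zero {G : List (List (ℕ × Fin h))} (hG : ∀ P ∈ G, P ≠ []) :
    G.map (window 0) = G.map fun P => [P] :=
  List.map_congr_left fun P hP => window_zero (hG P hP)

theorem vertices_map_singleton (G : List (List (ℕ × Fin h))) :
    vertices (G.map fun P => [P]) = G.flatten := by
  induction G with
  | nil => rfl
  | cons P G ih => simpa [vertices] using ih

theorem edgeCount_map_singleton (G : List (List (ℕ × Fin h))) :
    edgeCount (G.map fun P => [P]) = (G.flatMap pairs).length := by
  rw [edgeCount_eq]
  congr 1
  induction G with
  | nil => rfl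
  | cons P G ih => simpa using ih

theorem IsPartialWalk.isFirstFrame {G : List (List (ℕ × Fin h))} (hG : IsPartialWalk 1 G) :
    IsFirstFrame (G.map fun P => [P]) := by
  have hl := isChain_and_iff.1 hG.link
  refine ⟨by simp, ?_, ?_, ?_, ?_, ?_⟩
  · rw [← List.map_dropLast]
    intro S hS
    obtain ⟨P, hP, rfl⟩ := List.mem_map.1 hS
    simpa using hG.two_le P hP
  · obtain ⟨P, G, rfl⟩ := List.exists_cons_of_ne_nil hG.ne_empty
    have hc := hG.corner
    rw [List.flatten_cons, List.head?_append_of_ne_nil _ (hG.ne_nil P (by simp))] at hc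
    exact ⟨[P], by simp, by simpa using hc⟩
  · rw [← List.map_tail]
    intro S hS
    obtain ⟨P, hP, rfl⟩ := List.mem_map.1 hS
    have hne := hG.ne_nil P (List.mem_of_mem_tail hP)
    exact ⟨P.head hne, by simp [List.head?_eq_some_head hne],
      hl.2 P hP _ (by simp [List.head?_eq_some_head hne])⟩
  · rw [← List.map_dropLast]
    intro S hS
    obtain ⟨P, hP, rfl⟩ := List.mem_map.1 hS
    have hne := hG.ne_nil P (List.dropLast_subset _ hP)
    exact ⟨P.getLast hne, by simp [List.getLast?_eq_some_getLast hne],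
      hl.1 P hP _ (by simp [List.getLast?_eq_some_getLast hne])⟩
  · intro S hS e he hcond q hq hqw
    rw [List.getLast?_map, Option.mem_map] at hS
    obtain ⟨Q, hQ, rfl⟩ := hS
    rw [List.flatten_singleton] at he
    rw [vertices_map_singleton]
    obtain ⟨G₀, rfl⟩ := List.getLast?_eq_some_iff.1 hQ
    refine hG.trapped e ?_ ?_ q hq (by omega)
    · simpa [List.getLast?_append_of_ne_nil _ (hG.ne_nil Q (by simp))] using he
    · rcases hcond with hc | ⟨-, hc⟩
      · left
        omega
      · right
        simpa using hc

theorem IsFirstFrame.exists_isPartialWalk {F : Frame h 2} (hF : IsFirstFrame F.1) :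
    ∃ G, IsPartialWalk 1 G ∧ F.1 = G.map fun P => [P] := by
  obtain ⟨F, hfr⟩ := F
  simp only at hF ⊢
  obtain ⟨G, rfl⟩ : ∃ G : List (List (ℕ × Fin h)), F = G.map fun P => [P] := by
    have := hF.single_path
    clear hF hfr
    induction F with
    | nil => exact ⟨[], rfl⟩
    | cons S F ih =>
      rw [List.forall_mem_cons] at this
      obtain ⟨G, rfl⟩ := ih this.2
      obtain ⟨P, rfl⟩ := List.length_eq_one_iff.1 this.1
      exact ⟨P :: G, rfl⟩
  have hne : ∀ P ∈ G, P ≠ [] := fun P hP =>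
    hfr.path_ne_nil [P] (List.mem_map.2 ⟨P, hP, rfl⟩) P (by simp)
  have hGne : G ≠ [] := by
    rintro rfl
    obtain ⟨S, hS, -⟩ := hF.corner
    simp at hS
  have hnd := hfr.nodup
  have hwin := hfr.window
  rw [vertices_map_singleton] at hnd hwin
  obtain ⟨G₀, Q, hG₀⟩ := List.eq_nil_or_concat' G |>.resolve_left hGne
  have hQne : Q ≠ [] := hne Q (by simp [hG₀])
  have hlast : G.flatten.getLast? = Q.getLast? := by
    simp [hG₀, List.getLast?_append_of_ne_nil _ hQne]
  have htrap : ∀ e ∈ Q.getLast?, (e.1 = 0 ∨ (e.1 = 1 ∧ Q = [e])) →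
      ∀ q, (grid h).Adj e q → q.1 ≤ 1 → q ∈ G.flatten := by
    intro e he hcond q hq hq1
    have := hF.trapped [Q] (by simp [hG₀]) e (by simpa using he) (by simpa using hcond) q hq
      (by omega)
    rwa [vertices_map_singleton] at this
  refine ⟨G, ⟨hne, fun P hP => hfr.isChain [P] (List.mem_map.2 ⟨P, hP, rfl⟩) P (by simp), hnd,
    fun p hp => Nat.lt_succ_iff.1 (hwin p hp), ?_, isChain_and_iff.2 ⟨?_, ?_⟩, ?_, ?_, ?_⟩, rfl⟩
  · obtain ⟨P, G, rfl⟩ := List.exists_cons_of_ne_nil hGne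
    rw [List.flatten_cons, List.head?_append_of_ne_nil _ (hne P (by simp))]
    simpa using hF.corner
  · intro P hP e he
    obtain ⟨p, hp, hpc⟩ := hF.ends [P]
      (by rw [← List.map_dropLast]; exact List.mem_map.2 ⟨P, hP, rfl⟩)
    rw [List.flatten_singleton] at hp
    rwa [Option.mem_unique he hp]
  · intro P hP e he
    obtain ⟨p, hp, hpc⟩ := hF.starts [P]
      (by rw [← List.map_tail]; exact List.mem_map.2 ⟨P, hP, rfl⟩)
    rw [List.flatten_singleton] at hp
    rwa [Option.mem_unique he hp]
  · intro P hP
    simpa using hF.not_point [P] (by rw [← List.map_dropLast]; exact List.mem_map.2 ⟨P, hP, rfl⟩)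
  · intro e he hcond
    rw [hlast] at he
    refine htrap e he ?_
    have := hwin e (by rw [hG₀]; simp [List.mem_of_getLast? he])
    rcases hcond with hc | hc
    · left
      omega
    · have hQ : Q = [e] := by simpa [hG₀] using hc
      rcases Nat.lt_or_ge e.1 1 with h1 | h1
      · left
        omega
      · exact Or.inr ⟨by omega, hQ⟩
  · have hQ : Q.getLast hQne ∈ Q.getLast? := by simp [List.getLast?_eq_some_getLast hQne]
    have hmem : Q.getLast hQne ∈ G.flatten := by rw [hG₀]; simp
    have := hwin _ hmem
    rcases Nat.lt_or_ge (Q.getLast hQne).1 1 with h1 | h1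
    -- An end in column `0` is trapped, so its right neighbour is occupied and column `1` is
    -- reached.
    · refine ⟨(1, (Q.getLast hQne).2), htrap _ hQ (Or.inl (by omega)) _ ?_ le_rfl, rfl⟩
      exact Or.inr ⟨rfl, Or.inl (by simp only; omega)⟩
    · exact ⟨_, hmem, by omega⟩

/-- The number of edges of the strip that an edge of the directed graph adds. -/
def edgeLength {u v : State h} (e : u ⟶ v) : ℕ := e.1

/-- The number of edges of the strip that are collected along a walk of frames. -/
def total {u v : State h} (p : Quiver.Path u v) : ℕ := p.addWeight edgeLength

theorem total_nil (u : State h) : total (Quiver.Path.nil : Quiver.Path u u) = 0 :=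
  Quiver.Path.addWeight_nil _ _

theorem total_cons {u v w : State h} (p : Quiver.Path u v) (e : v ⟶ w) :
    total (p.cons e) = total p + e.1 :=
  Quiver.Path.addWeight_cons _ _ _

/-- The walk of frames records the partial walk `G` and its restrictions to fewer columns. -/
def Traces : ∀ {u : State h}, Quiver.Path (State.start : State h) u →
    List (List (ℕ × Fin h)) → Prop
  | _, .nil, _ => True
  | v, .cons p e, G => IsPartialWalk (p.length + 1) G ∧
      (∃ F : Frame h 2, v = .frame F ∧ F.1 = G.map (window p.length)) ∧
      total (p.cons e) = (G.flatMap pairs).length ∧ Traces p (restrict p.length G)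

theorem exists_traces {u : State h} (p : Quiver.Path (State.start : State h) u) :
    ∃ G, Traces p G := by
  induction p with
  | nil => exact ⟨[], trivial⟩
  | @cons b v p e ih =>
    obtain _ | F' := v
    · exact absurd e.2 (by cases b <;> simp [HasEdge])
    obtain ⟨G, hG⟩ := ih
    cases p with
    | nil =>
      obtain ⟨n, hF, hn⟩ := e
      obtain ⟨G, hG, hFG⟩ := hF.exists_isPartialWalk
      refine ⟨G, hG, ⟨F', rfl, ?_⟩, ?_, trivial⟩
      · rw [hFG]
        exact (map_window_zero hG.ne_nil).symm
      · rw [← edgeCount_map_singleton, ← hFG]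
        exact (total_cons _ _).trans
          ((congrArg (· + n) (total_nil _)).trans ((zero_add n).trans hn))
    | cons p e' =>
      obtain ⟨hGp, ⟨F, rfl, hF⟩, htot, htr⟩ := hG
      obtain ⟨n, X, hX, hF', hn⟩ := e
      obtain ⟨Y, hY, rfl, hXY⟩ := hGp.exists_extension hF hX
      refine ⟨Y, hY, ⟨F', rfl, ?_⟩, ?_, hGp, ⟨F, rfl, hF⟩, htot, htr⟩
      · rw [hF', hXY, trim_view]
        rfl
      · have h1 := hY.edgeCount_view
        rw [← hF, ← hXY] at h1
        have h2 : total ((p.cons e').cons (⟨n, X, hX, hF', hn⟩ : State.frame F ⟶ State.frame F')) =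
          total (p.cons e') + n := total_cons _ _
        omega

/-- The last column is removed, the restriction is traced by induction, and the picture of `G` in
three columns supplies the last edge. -/
theorem exists_path_of_isPartialWalk {i : ℕ} {G : List (List (ℕ × Fin h))}
    (hG : IsPartialWalk (i + 1) G) :
    ∃ (u : State h) (p : Quiver.Path (State.start : State h) u), p.length = i + 1 ∧ Traces p G := by
  induction i generalizing G with
  | zero =>
    let F : Frame h 2 := ⟨G.map (window 0), hG.isFrame (by omega) (by omega)⟩
    have hF : F.1 = G.map fun P => [P] := map_window_zero hG.ne_nil
    let e : (State.start : State h) ⟶ State.frame F :=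
      ⟨edgeCount F.1, by rw [hF]; exact hG.isFirstFrame, rfl⟩
    refine ⟨_, Quiver.Path.nil.cons e, rfl, hG, ⟨F, rfl, rfl⟩, ?_, trivial⟩
    rw [← edgeCount_map_singleton, ← hF]
    exact (total_cons _ _).trans ((congrArg (· + e.1) (total_nil _)).trans (zero_add e.1))
  | succ i ih =>
    obtain ⟨u, p, hp, hT⟩ := ih hG.restrict_columns
    cases p with
    | nil => simp at hp
    | cons p e' =>
      have hT' := hT
      obtain ⟨-, ⟨F, rfl, hF⟩, htot, -⟩ := hT'
      obtain rfl : p.length = i := by simpa using hp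
      let X : Frame h 3 := ⟨G.map (window p.length), hG.isFrame (by omega) (by omega)⟩
      let F' : Frame h 2 := ⟨G.map (window (p.length + 1)), hG.isFrame (by omega) (by omega)⟩
      have hle := edgeCount_restrict_le p.length (p.length + 1) G
      have hview := hG.edgeCount_view
      rw [← hF] at hle hview
      let e : State.frame F ⟶ State.frame F' :=
        ⟨edgeCount X.1 - edgeCount F.1, X, hG.isValidExtension hF rfl, (trim_view _ _).symm,
          (Nat.add_sub_of_le hle).symm⟩
      refine ⟨_, (p.cons e').cons e, rfl, hG, ⟨F', rfl, rfl⟩, ?_, hT⟩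
      have h2 : total ((p.cons e').cons e) =
          total (p.cons e') + (edgeCount X.1 - edgeCount F.1) := total_cons _ _
      have h3 : edgeCount X.1 = edgeCount (G.map (window p.length)) := rfl
      omega

/-- The last frame is a picture of `G`, the shorter walk traces a restriction of `G`, and the last
edge is fixed by its length, the difference of two totals. -/
theorem Traces.path_unique {u u' : State h} {p : Quiver.Path (State.start : State h) u}
    {p' : Quiver.Path (State.start : State h) u'} {G : List (List (ℕ × Fin h))}
    (hlen : p.length = p'.length) (hp : Traces p G) (hp' : Traces p' G) :
    (⟨u, p⟩ : Σ u, Quiver.Path (State.start : State h) u) = ⟨u', p'⟩ := by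
  induction p generalizing u' G with
  | nil =>
    cases p' with
    | nil => rfl
    | cons p' e' => simp at hlen
  | cons p e ih =>
    cases p' with
    | nil => simp at hlen
    | cons p' e' =>
      have hlen' : p.length = p'.length := by simpa using hlen
      obtain ⟨-, ⟨F, rfl, hF⟩, htot, htr⟩ := hp
      obtain ⟨-, ⟨F', rfl, hF'⟩, htot', htr'⟩ := hp'
      rw [← hlen'] at htr' hF'
      obtain ⟨rfl, hpp⟩ := Sigma.mk.inj (ih hlen' htr htr')
      obtain rfl := eq_of_heq hpp
      obtain rfl : F = F' := Subtype.ext (hF.trans hF'.symm)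
      obtain rfl : e = e' := by
        have h1 : total (p.cons e) = total p + e.1 := total_cons _ _
        have h2 : total (p.cons e') = total p + e'.1 := total_cons _ _
        exact Subtype.ext (by omega)
      rfl

/-- An edge in the last two columns is read off the last frame; any other edge survives in the
restriction and was recorded earlier. -/
theorem Traces.mem_pairs {u : State h} {p : Quiver.Path (State.start : State h) u}
    {G G' : List (List (ℕ × Fin h))} (hlen : p.length ≠ 0) (hG : Traces p G) (hG' : Traces p G')
    {x : (ℕ × Fin h) × (ℕ × Fin h)} (hx : x ∈ G.flatMap pairs) : x ∈ G'.flatMap pairs := by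
  induction p generalizing G G' with
  | nil => simp at hlen
  | cons p e ih =>
    obtain ⟨hw, ⟨F, rfl, hF⟩, -, htr⟩ := hG
    obtain ⟨-, ⟨F', hFF, hF'⟩, -, htr'⟩ := hG'
    obtain rfl : F = F' := by simpa using hFF
    have hadj := adj_col (hw.pairs_adj x hx)
    by_cases hi : p.length ≤ x.1.1 ∧ p.length ≤ x.2.1
    · have h1 : Prod.map (shift p.length) (shift p.length) x ∈ F.1.flatten.flatMap pairs := by
        rw [hF, pairs_view]
        exact List.mem_map.2 ⟨x, List.mem_filter.2 ⟨hx, by simpa using hi⟩, rfl⟩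
      rw [hF', pairs_view] at h1
      obtain ⟨y, hy, hyx⟩ := List.mem_map.1 h1
      simp only [List.mem_filter, Bool.and_eq_true, decide_eq_true_eq] at hy
      have hyx' := Prod.ext_iff.1 hyx
      have : y = x := Prod.ext (shift_inj hy.2.1 hi.1 hyx'.1) (shift_inj hy.2.2 hi.2 hyx'.2)
      exact this ▸ hy.1
    -- One point is left of column `p.length`, so both are in the columns `≤ p.length`. If `p` is
    -- empty there is no such column and this case does not arise.
    · have := ih (by omega) htr htr' (by
        rw [pairs_restrict, List.mem_filter]
        refine ⟨hx, ?_⟩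
        simp only [Bool.and_eq_true, decide_eq_true_eq]
        omega)
      rw [pairs_restrict] at this
      exact (List.mem_filter.1 this).1

end Traces

/-! ## The bijection -/

section Bijection

variable {h : ℕ}

theorem weight_eq {u v : State h} (p : Quiver.Path u v) :
    p.weight edgeWeight =
      (MvPolynomial.X 0 ^ total p * MvPolynomial.X 1 ^ p.length : MvPolynomial (Fin 2) ℤ) := by
  induction p with
  | nil => simp [total_nil]
  | cons p e ih =>
    rw [Quiver.Path.weight_cons, ih, edgeWeight, total_cons, Quiver.Path.length_cons]
    ring

theorem X_pow_mul_X_pow (a b : ℕ) :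
    (MvPolynomial.X 0 ^ a * MvPolynomial.X 1 ^ b : MvPolynomial (Fin 2) ℤ) =
      MvPolynomial.monomial (Finsupp.single 0 a + Finsupp.single 1 b) 1 := by
  rw [MvPolynomial.X_pow_eq_monomial, MvPolynomial.X_pow_eq_monomial, MvPolynomial.monomial_mul,
    one_mul]

theorem weight_eq_iff {u v : State h} (p : Quiver.Path u v) (n k : ℕ) :
    p.weight edgeWeight =
        (MvPolynomial.X 0 ^ n * MvPolynomial.X 1 ^ k : MvPolynomial (Fin 2) ℤ) ↔
      total p = n ∧ p.length = k := by
  rw [weight_eq]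
  constructor
  · intro hp
    rw [X_pow_mul_X_pow, X_pow_mul_X_pow] at hp
    have hs := MvPolynomial.monomial_left_injective (one_ne_zero (α := ℤ)) hp
    have h0 := DFunLike.congr_fun hs 0
    have h1 := DFunLike.congr_fun hs 1
    simp at h0 h1
    exact ⟨h0, h1⟩
  · rintro ⟨rfl, rfl⟩
    rfl

theorem GSAW.ext_support {V : Type*} {G : SimpleGraph V} {v : V} {W W' : GSAW G v}
    (hW : W.walk.support = W'.walk.support) : W = W' := by
  obtain ⟨l, w, h1, h2⟩ := W
  obtain ⟨l', w', h1', h2'⟩ := W'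
  simp only at hW
  obtain rfl : l = l' := by
    rw [← w.getLast_support, ← w'.getLast_support]
    simp only [hW]
  obtain rfl : w = w' := SimpleGraph.Walk.ext_support hW
  rfl

/-- The start lies in column `0`, so the displacement is the largest column visited. -/
theorem GSAW.displacement_eq_iff {hh : 0 < h} (W : GSAW (grid h) (topLeft h hh)) (k : ℕ) :
    W.displacement = k ↔ (∀ p ∈ W.walk.support, p.1 ≤ k) ∧ ∃ p ∈ W.walk.support, p.1 = k := by
  have hfin : (Prod.fst '' {p | p ∈ W.walk.support}).Finite :=
    (List.finite_toSet W.walk.support).image _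
  have h0 : 0 ∈ Prod.fst '' {p | p ∈ W.walk.support} :=
    ⟨topLeft h hh, W.walk.start_mem_support, rfl⟩
  have hinf : sInf (Prod.fst '' {p | p ∈ W.walk.support}) = 0 :=
    Nat.sInf_eq_zero.2 (Or.inl h0)
  rw [GSAW.displacement, hinf, Nat.sub_zero]
  have hmem := Nat.sSup_mem ⟨0, h0⟩ hfin.bddAbove
  constructor
  · rintro rfl
    refine ⟨fun p hp => le_csSup hfin.bddAbove ⟨p, hp, rfl⟩, ?_⟩
    obtain ⟨p, hp, hpk⟩ := hmem
    exact ⟨p, hp, hpk⟩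
  · rintro ⟨hle, p, hp, rfl⟩
    refine le_antisymm ?_ (le_csSup hfin.bddAbove ⟨p, hp, rfl⟩)
    obtain ⟨q, hq, hqk⟩ := hmem
    rw [← hqk]
    exact hle q hq

theorem exists_gsaw_of_accepted {hh : 0 < h} {n k : ℕ} (w : AcceptedWalks h n k) :
    ∃ W : GSAWs h hh n k, Traces w.1.2 [W.1.walk.support] := by
  obtain ⟨⟨⟨t, ht⟩, p⟩, hw⟩ := w
  simp only at hw ⊢
  obtain ⟨htot, hlen⟩ := (weight_eq_iff p n k).1 hw
  obtain ⟨G, hG⟩ := exists_traces p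
  have hTr := hG
  cases p with
  | nil => exact ht.elim
  | cons p e =>
    obtain ⟨hP, ⟨F, rfl, hF⟩, htotG, -⟩ := hG
    obtain ⟨S, hS, a, ha, ha0⟩ := ht
    rw [hS] at hF
    obtain ⟨Q, G, rfl, rfl, hG⟩ := List.map_eq_cons_iff.1 hF.symm
    obtain rfl : G = [] := by simpa using hG
    have hQch := hP.isChain Q (by simp)
    obtain ⟨x, hx, hx0, hxh⟩ := hP.corner
    rw [List.flatten_singleton] at hx
    obtain rfl : x = topLeft h hh := by
      refine Prod.ext hx0 (Fin.ext ?_)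
      simp only [topLeft]
      omega
    obtain ⟨Q, rfl⟩ := List.head?_eq_some_iff.1 hx
    have hnd : (topLeft h hh :: Q).Nodup := by simpa using hP.nodup
    have hlast := List.getLast?_eq_some_getLast (List.cons_ne_nil (topLeft h hh) Q)
    -- An end in the newest column would be the last visible point and would appear in column `1` of
    -- the frame, contrary to acceptance. Hence all its neighbours are within the columns swept so
    -- far.
    have hlt : ((topLeft h hh :: Q).getLast (by simp)).1 < p.length + 1 := by
      by_contra hge
      have := getLast_filter_of_mem (i := p.length) hlast (by omega)
      rw [flatten_window, List.getLast?_map, Option.mem_map] at ha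
      obtain ⟨b, hb, rfl⟩ := ha
      rw [Option.mem_unique hb this] at ha0
      simp only [shift] at ha0
      omega
    let w : (grid h).Walk (topLeft h hh) ((topLeft h hh :: Q).getLast (by simp)) :=
      SimpleGraph.Walk.ofSupport (topLeft h hh :: Q) (by simp) hQch
    have hsup : w.support = topLeft h hh :: Q := SimpleGraph.Walk.support_ofSupport _ _
    let W : GSAW (grid h) (topLeft h hh) :=
      ⟨_, w, by rw [SimpleGraph.Walk.isPath_def, hsup]; exact hnd, by
        intro q hq
        rw [hsup]
        have := hP.trapped _ (by simpa using hlast) (Or.inl hlt) q hq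
          (by have := adj_col hq; omega)
        simpa using this⟩
    have hWs : W.walk.support = topLeft h hh :: Q := hsup
    refine ⟨⟨W, ?_, ?_⟩, ?_⟩
    · have h1 := W.walk.length_support
      rw [hWs] at h1
      have h2 : W.length = W.walk.length := rfl
      simp only [List.flatMap_cons, List.flatMap_nil, List.append_nil, length_pairs] at htotG
      omega
    · rw [GSAW.displacement_eq_iff, hWs, ← hlen]
      refine ⟨fun p hp => hP.le p (by simpa using hp), ?_⟩
      simpa using hP.exists_col
    · simp only [hWs]
      exact hTr

theorem exists_accepted_of_gsaw {hh : 0 < h} {n k : ℕ} (W : GSAWs h hh n k) :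
    ∃ w : AcceptedWalks h n k, Traces w.1.2 [W.1.walk.support] := by
  obtain ⟨W, rfl, hk⟩ := W
  simp only
  obtain ⟨hle, x, hx, hxk⟩ := (GSAW.displacement_eq_iff W k).1 hk
  have hne := W.walk.support_ne_nil
  have hlast : W.walk.support.getLast? = some W.last := by
    rw [List.getLast?_eq_some_getLast hne, W.walk.getLast_support]
  -- The strip is unbounded to the right, so the trapped end has a right neighbour, which is
  -- visited. This gives `k ≥ 1` and an end left of column `k`.
  have hright : (W.last.1 + 1, W.last.2) ∈ W.walk.support :=
    W.trapped _ (Or.inr ⟨rfl, Or.inl rfl⟩)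
  obtain ⟨i, rfl⟩ : ∃ i, k = i + 1 := ⟨k - 1, by have := hle _ hright; simp only at this; omega⟩
  have hlt : W.last.1 ≤ i := by simpa using hle _ hright
  have hch := W.walk.isChain_adj_support
  have hP : IsPartialWalk (i + 1) [W.walk.support] := by
    refine ⟨by simp, by simpa using hch, ?_, by simpa using hle, ?_, by simp, by simp, ?_, ?_⟩
    · simpa using W.isPath.support_nodup
    · refine ⟨topLeft h hh, ?_, rfl, ?_⟩
      · rw [List.flatten_singleton, List.head?_eq_some_head hne, W.walk.head_support]
        rfl
      · simp only [topLeft]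
        omega
    · intro e he _ q hq _
      rw [List.flatten_singleton] at he ⊢
      rw [hlast] at he
      obtain rfl : W.last = e := by simpa using he
      exact W.trapped q hq
    · exact ⟨x, by simpa using hx, hxk⟩
  obtain ⟨u, p, hp, hT⟩ := exists_path_of_isPartialWalk hP
  have hT' := hT
  cases p with
  | nil => simp at hp
  | cons p e =>
    obtain ⟨-, ⟨F, rfl, hF⟩, htot, -⟩ := hT'
    have hpi : p.length = i := by simpa using hp
    rw [hpi] at hF
    refine ⟨⟨⟨⟨State.frame F, window i W.walk.support, by simpa using hF, ?_⟩, p.cons e⟩, ?_⟩, hT⟩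
    · have hfne : (W.walk.support.filter fun p => decide (i ≤ p.1)) ≠ [] :=
        List.ne_nil_of_mem (List.mem_filter.2 ⟨hx, by simp; omega⟩)
      have he := List.getLast?_eq_some_getLast hfne
      generalize List.getLast _ hfne = e' at he
      refine ⟨shift i e', ?_, ?_⟩
      · rw [flatten_window, List.getLast?_map, Option.mem_map]
        exact ⟨e', he, rfl⟩
      · have hi : i ≤ e'.1 := by
          simpa using (List.mem_filter.1 (List.mem_of_getLast? he)).2
        simp only [shift]
        rcases getLast_filter hch hlast he with rfl | h1
        · omega
        · omega
    · rw [weight_eq_iff]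
      refine ⟨?_, hp⟩
      rw [htot]
      simp [length_pairs, GSAW.length]

theorem gsaw_unique {hh : 0 < h} {n k : ℕ} {w : AcceptedWalks h n k} {W W' : GSAWs h hh n k}
    (hW : Traces w.1.2 [W.1.walk.support]) (hW' : Traces w.1.2 [W'.1.walk.support]) : W = W' := by
  have hlen : w.1.2.length ≠ 0 := by
    obtain ⟨⟨⟨t, ht⟩, p⟩, -⟩ := w
    cases p with
    | nil => exact ht.elim
    | cons p e => simp
  refine Subtype.ext (GSAW.ext_support (eq_of_pairs W.1.isPath.support_nodup
    W'.1.isPath.support_nodup ?_ fun x => ⟨fun hx => ?_, fun hx => ?_⟩))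
  · rw [List.head?_eq_some_head W.1.walk.support_ne_nil,
      List.head?_eq_some_head W'.1.walk.support_ne_nil, W.1.walk.head_support,
      W'.1.walk.head_support]
  · simpa using hW.mem_pairs hlen hW' (by simpa using hx)
  · simpa using hW'.mem_pairs hlen hW (by simpa using hx)

theorem accepted_unique {n k : ℕ} {w w' : AcceptedWalks h n k} {G : List (List (ℕ × Fin h))}
    (hw : Traces w.1.2 G) (hw' : Traces w'.1.2 G) : w = w' := by
  obtain ⟨⟨⟨t, ht⟩, p⟩, hp⟩ := w
  obtain ⟨⟨⟨t', ht'⟩, p'⟩, hp'⟩ := w'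
  have hlen : p.length = p'.length :=
    ((weight_eq_iff p n k).1 hp).2.trans ((weight_eq_iff p' n k).1 hp').2.symm
  obtain ⟨rfl, hpp⟩ := Sigma.mk.inj (Traces.path_unique hlen hw hw')
  obtain rfl := eq_of_heq hpp
  rfl

theorem nonempty_equiv (hh : 0 < h) (n k : ℕ) :
    Nonempty (AcceptedWalks h n k ≃ GSAWs h hh n k) := by
  choose f hf using fun w : AcceptedWalks h n k => exists_gsaw_of_accepted (hh := hh) w
  refine ⟨Equiv.ofBijective f ⟨fun w w' hww => ?_, fun W => ?_⟩⟩
  · exact accepted_unique (hf w) (hww ▸ hf w')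
  · obtain ⟨w, hw⟩ := exists_accepted_of_gsaw W
    exact ⟨w, gsaw_unique (hf w) hw⟩

theorem finite_gsaws (hh : 0 < h) (n k : ℕ) : Finite (GSAWs h hh n k) := by
  have hs : {p : ℕ × Fin h | p.1 ≤ k}.Finite :=
    ((Set.finite_le_nat k).prod (Set.finite_univ (α := Fin h))).subset fun p hp => ⟨hp, trivial⟩
  have := (finite_lists hs (n + 1)).to_subtype
  refine Finite.of_injective
    (β := {l : List (ℕ × Fin h) | (∀ x ∈ l, x ∈ {p : ℕ × Fin h | p.1 ≤ k}) ∧ l.length ≤ n + 1})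
    (fun W => ⟨W.1.walk.support, ?_, ?_⟩) ?_
  · exact ((GSAW.displacement_eq_iff W.1 k).1 W.2.2).1
  · rw [W.1.walk.length_support]
    exact Nat.succ_le_succ W.2.1.le
  · intro W W' hWW
    exact Subtype.ext (GSAW.ext_support (congrArg Subtype.val hWW))

end Bijection

/-! ## The transfer matrix method -/

section Transfer

variable {h : ℕ}

/-- A walk with `j + 1` edges is a walk with `j` edges followed by an edge. -/
def pathSuccEquiv {V : Type*} [Quiver V] (u v : V) (j : ℕ) :
    {p : Quiver.Path u v // p.length = j + 1} ≃
      Σ w, {p : Quiver.Path u w // p.length = j} × (w ⟶ v) where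
  toFun
    | ⟨.cons p e, hp⟩ => ⟨_, ⟨p, Nat.succ.inj hp⟩, e⟩
  invFun x := ⟨x.2.1.1.cons x.2.2, congrArg Nat.succ x.2.1.2⟩
  left_inv
    | ⟨.cons _ _, _⟩ => rfl
  right_inv _ := rfl

instance finite_paths (u v : State h) (j : ℕ) :
    Finite {p : Quiver.Path u v // p.length = j} := by
  induction j generalizing v with
  | zero =>
    have : Subsingleton {p : Quiver.Path u v // p.length = 0} := ⟨by
      rintro ⟨_ | ⟨p, e⟩, hp⟩ ⟨p', hp'⟩
      · exact Subtype.ext (Quiver.Path.eq_nil_of_length_zero p' hp').symm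
      · simp at hp⟩
    infer_instance
  | succ j ih => exact Finite.of_equiv _ (pathSuccEquiv u v j).symm

noncomputable instance fintypePaths (u v : State h) (j : ℕ) :
    Fintype {p : Quiver.Path u v // p.length = j} := Fintype.ofFinite _

/-- The adjacency matrix over the formal power series. -/
noncomputable def seriesAdjacency (h : ℕ) :
    Matrix (State h) (State h) (MvPowerSeries (Fin 2) ℤ) :=
  (adjacency h).map fun p => (p : MvPowerSeries (Fin 2) ℤ)

theorem seriesAdjacency_apply (u v : State h) :
    seriesAdjacency h u v = ∑ e : (u ⟶ v), (MvPowerSeries.X 0 ^ e.1 * MvPowerSeries.X 1) := by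
  have : ((∑ e : (u ⟶ v), edgeWeight e : MvPolynomial (Fin 2) ℤ) : MvPowerSeries (Fin 2) ℤ) =
      ∑ e : (u ⟶ v), ((edgeWeight e : MvPolynomial (Fin 2) ℤ) : MvPowerSeries (Fin 2) ℤ) :=
    map_sum (MvPolynomial.coeToMvPowerSeries.ringHom (σ := Fin 2) (R := ℤ)) _ _
  rw [seriesAdjacency, Matrix.map_apply, adjacency, Matrix.of_apply, this]
  simp [edgeWeight]

theorem seriesAdjacency_pow_apply (u v : State h) (j : ℕ) :
    (seriesAdjacency h ^ j) u v = ∑ p : {p : Quiver.Path u v // p.length = j},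
      (MvPowerSeries.X 0 ^ total p.1 * MvPowerSeries.X 1 ^ j) := by
  induction j generalizing v with
  | zero =>
    rw [pow_zero]
    by_cases huv : u = v
    · subst huv
      have : Unique {p : Quiver.Path u u // p.length = 0} :=
        ⟨⟨⟨.nil, rfl⟩⟩, fun p => Subtype.ext (Quiver.Path.eq_nil_of_length_zero p.1 p.2)⟩
      rw [Matrix.one_apply_eq, Fintype.sum_unique]
      have h0 : total (default : {p : Quiver.Path u u // p.length = 0}).1 = 0 := by
        rw [Quiver.Path.eq_nil_of_length_zero _ (default : {p : Quiver.Path u u // p.length = 0}).2,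
          total_nil]
      simp [h0]
    · have : IsEmpty {p : Quiver.Path u v // p.length = 0} :=
        ⟨fun p => huv (Quiver.Path.eq_of_length_zero p.1 p.2)⟩
      rw [Matrix.one_apply_ne huv, Finset.univ_eq_empty, Finset.sum_empty]
  | succ j ih =>
    rw [pow_succ, Matrix.mul_apply, Fintype.sum_equiv (pathSuccEquiv u v j) _
      (fun x => (MvPowerSeries.X 0 ^ total x.2.1.1 * MvPowerSeries.X 1 ^ j) *
        (MvPowerSeries.X 0 ^ x.2.2.1 * MvPowerSeries.X 1)), Fintype.sum_sigma]
    · refine Finset.sum_congr rfl fun w _ => ?_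
      rw [ih, seriesAdjacency_apply, Finset.sum_mul_sum, Fintype.sum_prod_type]
    · rintro ⟨_ | ⟨p, e⟩, hp⟩
      · simp at hp
      · simp only [pathSuccEquiv, Equiv.coe_fn_mk, total_cons]
        ring

theorem coeff_X_pow_mul_X_pow (m : Fin 2 →₀ ℕ) (a b : ℕ) :
    MvPowerSeries.coeff m (MvPowerSeries.X 0 ^ a * MvPowerSeries.X 1 ^ b :
      MvPowerSeries (Fin 2) ℤ) = if a = m 0 ∧ b = m 1 then 1 else 0 := by
  rw [MvPowerSeries.X_pow_eq, MvPowerSeries.X_pow_eq, MvPowerSeries.monomial_mul_monomial,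
    MvPowerSeries.coeff_monomial, one_mul]
  refine if_congr ?_ rfl rfl
  constructor
  · rintro rfl
    simp
  · rintro ⟨rfl, rfl⟩
    ext i
    fin_cases i <;> simp

theorem X_dvd_seriesAdjacency_pow (u v : State h) (j : ℕ) :
    (MvPowerSeries.X 1 : MvPowerSeries (Fin 2) ℤ) ^ j ∣ (seriesAdjacency h ^ j) u v := by
  rw [seriesAdjacency_pow_apply]
  exact Finset.dvd_sum fun p _ => Dvd.intro_left _ rfl

/-- Every edge weight has a factor `y`, so the matrix of constant terms is the identity. -/
theorem isUnit_det_oneSubAdjacency (h : ℕ) : IsUnit (oneSubAdjacency h).det := by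
  rw [MvPowerSeries.isUnit_iff_constantCoeff, RingHom.map_det]
  suffices hs : (MvPowerSeries.constantCoeff (σ := Fin 2) (R := ℤ)).mapMatrix
      (oneSubAdjacency h) = 1 by
    rw [hs, Matrix.det_one]
    exact isUnit_one
  rw [oneSubAdjacency, RingHom.mapMatrix_apply]
  ext u v
  have h0 : MvPowerSeries.constantCoeff (seriesAdjacency h u v) = 0 := by
    rw [seriesAdjacency_apply, map_sum]
    exact Finset.sum_eq_zero fun e _ => by simp
  rw [Matrix.map_apply, Matrix.sub_apply, map_sub]
  change _ - MvPowerSeries.constantCoeff (seriesAdjacency h u v) = _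
  rw [h0, sub_zero, Matrix.one_apply, Matrix.one_apply]
  split <;> simp

/-- The exponent of `y` counts the edges of a walk, so in the geometric series only the power `m 1`
contributes to the coefficient at `m`. -/
theorem coeff_inv_oneSubAdjacency (u v : State h) (m : Fin 2 →₀ ℕ) :
    MvPowerSeries.coeff m ((oneSubAdjacency h)⁻¹ u v) =
      Nat.card {p : Quiver.Path u v // total p = m 0 ∧ p.length = m 1} := by
  have hU := Matrix.mul_nonsing_inv _ (isUnit_det_oneSubAdjacency h)
  have hone : oneSubAdjacency h = 1 - seriesAdjacency h := rfl
  -- The series is cut after the power `m 1`; the remainder is divisible by `y ^ (m 1 + 1)` and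
  -- cannot affect this coefficient.
  have hgeom : (oneSubAdjacency h)⁻¹ =
      ∑ j ∈ Finset.range (m 1 + 1), seriesAdjacency h ^ j +
        seriesAdjacency h ^ (m 1 + 1) * (oneSubAdjacency h)⁻¹ := by
    have := congrArg (· * (oneSubAdjacency h)⁻¹) (geom_sum_mul_neg (seriesAdjacency h) (m 1 + 1))
    simp only [← hone, Matrix.mul_assoc, hU, Matrix.mul_one, Matrix.sub_mul, Matrix.one_mul] at this
    rw [this]
    abel
  have hrest : MvPowerSeries.coeff m
      ((seriesAdjacency h ^ (m 1 + 1) * (oneSubAdjacency h)⁻¹) u v) = 0 := by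
    have hdvd : (MvPowerSeries.X 1 : MvPowerSeries (Fin 2) ℤ) ^ (m 1 + 1) ∣
        (seriesAdjacency h ^ (m 1 + 1) * (oneSubAdjacency h)⁻¹) u v := by
      rw [Matrix.mul_apply]
      exact Finset.dvd_sum fun w _ => (X_dvd_seriesAdjacency_pow u w _).mul_right _
    exact MvPowerSeries.X_pow_dvd_iff.1 hdvd m (Nat.lt_succ_self _)
  rw [hgeom, Matrix.add_apply, map_add, hrest, add_zero, Matrix.sum_apply, map_sum]
  simp only [seriesAdjacency_pow_apply, map_sum, coeff_X_pow_mul_X_pow]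
  rw [Finset.sum_eq_single (m 1)]
  · simp only [and_true, Finset.sum_boole]
    rw [← Fintype.card_subtype, ← Nat.card_eq_fintype_card]
    congr 1
    exact Nat.card_congr ⟨fun p => ⟨p.1.1, p.2, p.1.2⟩, fun p => ⟨⟨p.1, p.2.2⟩, p.2.1⟩,
      fun _ => rfl, fun _ => rfl⟩
  · intro j _ hj
    simp [hj]
  · simp

/-- An accepted walk is a walk to an accepting vertex with prescribed numbers of edges. -/
def acceptedWalksEquiv (h n k : ℕ) :
    AcceptedWalks h n k ≃ Σ t : AcceptingState h,
      {p : Quiver.Path (State.start : State h) t.1 // total p = n ∧ p.length = k} where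
  toFun w := ⟨w.1.1, w.1.2, (weight_eq_iff w.1.2 n k).1 w.2⟩
  invFun x := ⟨⟨x.1, x.2.1⟩, (weight_eq_iff x.2.1 n k).2 x.2.2⟩
  left_inv _ := rfl
  right_inv _ := rfl

theorem gsawSeries_eq (hh : 0 < h) :
    gsawSeries h hh = ∑ t : AcceptingState h, (oneSubAdjacency h)⁻¹ State.start t.1 := by
  ext m
  have hfin : ∀ t : AcceptingState h,
      Finite {p : Quiver.Path (State.start : State h) t.1 // total p = m 0 ∧ p.length = m 1} :=
    fun t => Finite.of_injective
      (β := {p : Quiver.Path (State.start : State h) t.1 // p.length = m 1})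
      (fun p => ⟨p.1, p.2.2⟩) fun p q hpq => Subtype.ext (congrArg (fun x => x.1) hpq)
  rw [map_sum]
  simp only [coeff_inv_oneSubAdjacency]
  change (Nat.card (GSAWs h hh (m 0) (m 1)) : ℤ) = _
  obtain ⟨e⟩ := nonempty_equiv hh (m 0) (m 1)
  rw [← Nat.card_congr e, Nat.card_congr (acceptedWalksEquiv h (m 0) (m 1)), Nat.card_sigma]
  push_cast
  rfl

end Transfer

end Strip

theorem mainTheorem1 (h : ℕ) (hh : 0 < h) :
    (∀ n k : ℕ, Nonempty (Strip.AcceptedWalks h n k ≃ Strip.GSAWs h hh n k)) ∧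
    (∀ n k : ℕ, Finite (Strip.GSAWs h hh n k)) ∧
    IsUnit (Strip.oneSubAdjacency h).det ∧
    Strip.gsawSeries h hh =
      ∑ t : Strip.AcceptingState h, (Strip.oneSubAdjacency h)⁻¹ Strip.State.start t.1 :=
  ⟨Strip.nonempty_equiv hh, Strip.finite_gsaws hh, Strip.isUnit_det_oneSubAdjacency h,
    Strip.gsawSeries_eq hh⟩
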